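/- Let $R$ be a commutative ring with unit. **Spectral sequences.** An $r$-bigraded complex is a bigraded $R$-module $A=\{A^{p,n}\}_{p,n\in\mathbb Z}$ with differentials $d_r\colon A^{p,n}\to A^{p-r,n+1-r}$, $d_r^2=0$. An extended spectral sequence $X$ is a family of $r$-bigraded complexes $X_r$ ($r\ge 0$) with maps of bigraded modules $\varphi_{r+1}\colon X_{r+1}\to H(X_r)$ (the characteristic maps); morphisms are families of morphisms of $r$-bigraded complexes compatible with the characteristic maps. It is a spectral sequence if all $\varphi_{r+1}$ are isomorphisms. Let $\mathcal T^{-1}$ be the translation of bigraded modules $(\mathcal T^{-1}A)^{p,n}=A^{2p-n,p}$, that is, $(\mathcal T^{-1}A)^{p,p+k}=A^{p-k,p}$; it turns $(r+1)$-bigraded complexes into $r$-bigraded complexes. **Décalage of spectral sequences.** For an extended spectral sequence $X$, a sequence $(x_0,\dots,x_m)$ with $x_i\in X_i^{p,n}$ is compatible if $d_ix_i=0$ and $\varphi_{i+1}(x_{i+1})=[x_i]$ for all $0\le i<m$. Let $\mathcal N(X)_r^{p,n}$ be the module of pairs $(x_0,\dots,x_r;\,y_0,\dots,y_r)$ of compatible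 sequences in bidegrees $(p,n)$ and $(p-r,n+1-r)$ with $d_rx_r=y_r$, equipped with $$d(x;y)=(y;0),\qquad w(x;y)=(x_0,\dots,x_{r-1};0),\qquad s(x;y)=(0;\,y_0,\dots,y_r,0),$$ where $w\colon \mathcal N(X)_r\to\mathcal N(X)_{r-1}$ ($r\geq 1$) and $s\colon\mathcal N(X)_r\to\mathcal N(X)_{r+1}$ has bidegree $(1,1)$. The extended spectral sequence $\operatorname{Dec}(X)$ has the pages $$\operatorname{Dec}(X)_0=\mathcal T^{-1}\big(\mathcal N(X)_1\big),\qquad \operatorname{Dec}(X)_r=\mathcal T^{-1}\big(\mathcal N(X)_{r+1}/(\operatorname{Im}s+d\operatorname{Im}s)\big)\quad(r\ge1),$$ with the differentials induced by $d$ and the characteristic maps $\bar a\mapsto[\,\overline{w(a)}\,]$; for $r\ge1$ the projection $(x;y)\mapsto x_{r+1}$ identifies $\operatorname{Dec}(X)_r$ with $\mathcal T^{-1}X_{r+1}$. If $X$ is a spectral sequence, then so is $\operatorname{Dec}(X)$. **Filtered complexes.** A filtered complex $C$ is a cochain complex of $R$-modules with an increasing filtration by subcomplexes $F_pC$, $p\in\mathbb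 Z$. Put $Z_r^{p,p+k}(C)=F_pC^k\cap d^{-1}(F_{p-r}C^{k+1})$, $B_0^{p,p+k}(C)=F_{p-1}C^k$ and $B_{r+1}^{p,p+k}(C)=Z_{r}^{p-1,p-1+k}(C)+d\,Z_{r}^{p+r,p+r+k-1}(C)$. The spectral sequence $E(C)$ has pages $E(C)_r=Z_r(C)/B_r(C)$, with the differentials induced by $d$ and characteristic maps $[x]_{r+1}\mapsto[[x]_r]$, where $[x]_r$ denotes the class of $x$ in $E(C)_r$. Deligne's décalage $\operatorname{Dec}(C)$ is the same complex with the filtration $(\operatorname{Dec}F)_pC^k=F_{p-k}C^k\cap d^{-1}(F_{p-k-1}C^{k+1})$. **Proposition.** There is an isomorphism of spectral sequences $$\tilde u_C\colon E(\operatorname{Dec}(C))\longrightarrow\operatorname{Dec}(E(C)),$$ natural in the filtered complex $C$. On the $0$-page it is given by $$[x]\longmapsto([x]_0,[x]_1;\,[dx]_0,[dx]_1),$$ and on the $r$-page, for $r\ge1$, it sends $[x]$ to the class of $([x]_0,\dots,[x]_{r+1};\,[dx]_0,\dots,[dx]_{r+1})$; under the identification of $\operatorname{Dec}(E(C))_r$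 with $\mathcal T^{-1}E(C)_{r+1}$ this is the map $[x]\mapsto[x]_{r+1}$. -/

import Mathlib

open CategoryTheory

universe u v

/-!
Grading convention. A bigraded `R`-module `A` is stored by filtration degree and total degree:
`A.X p k` is the component of bidegree `(p, p + k)`. In these coordinates a differential of
bidegree `(-r, 1 - r)` goes from `(p, k)` to `(p - r, k + 1)`, and a map of bidegree `(1, 1)` goes
from `(p, k)` to `(p + 1, k)`.
Maps that change the degree take the target degree as an argument, with the (unique) equation it
satisfies, so that no transport along equalities of integers is needed.
-/

/-- `r`-bigraded complexes of `R`-modules. -/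
structure BigradedComplex (R : Type u) [CommRing R] (r : ℕ) where
  X : ℤ → ℤ → ModuleCat.{v} R
  d : ∀ p k p' k' : ℤ, p' + r = p → k + 1 = k' → (X p k →ₗ[R] X p' k')
  d_d : ∀ (p k p' k' p'' k'' : ℤ) (hp : p' + r = p) (hk : k + 1 = k') (hp' : p'' + r = p')
    (hk' : k' + 1 = k'') (x : X p k), d p' k' p'' k'' hp' hk' (d p k p' k' hp hk x) = 0

namespace BigradedComplex

variable {R : Type u} [CommRing R] {r : ℕ}

/-- Morphisms of `r`-bigraded complexes. -/
@[ext]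
structure Hom (A B : BigradedComplex.{u, v} R r) where
  f : ∀ p k : ℤ, A.X p k →ₗ[R] B.X p k
  comm : ∀ (p k p' k' : ℤ) (hp : p' + r = p) (hk : k + 1 = k') (x : A.X p k),
    f p' k' (A.d p k p' k' hp hk x) = B.d p k p' k' hp hk (f p k x)

instance : Category (BigradedComplex.{u, v} R r) where
  Hom A B := Hom A B
  id A := { f := fun _ _ => LinearMap.id, comm := fun _ _ _ _ _ _ _ => rfl }
  comp f g :=
    { f := fun p k => (g.f p k).comp (f.f p k)
      comm := fun p k p' k' hp hk x => by simp [f.comm, g.comm] }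

/-- The cycles of `A` in degree `(p, k)`. -/
def cycles (A : BigradedComplex.{u, v} R r) (p k : ℤ) : Submodule R (A.X p k) :=
  LinearMap.ker (A.d p k (p - r) (k + 1) (by omega) rfl)

/-- The boundaries of `A` in degree `(p, k)`. -/
def boundaries (A : BigradedComplex.{u, v} R r) (p k : ℤ) : Submodule R (A.X p k) :=
  LinearMap.range (A.d (p + r) (k - 1) p k rfl (by omega))

/-- The homology of `A` in degree `(p, k)`. -/
abbrev homology (A : BigradedComplex.{u, v} R r) (p k : ℤ) : Type v :=
  A.cycles p k ⧸ (A.boundaries p k).submoduleOf (A.cycles p k)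

/-- The homology class of a cycle. -/
def homologyMk (A : BigradedComplex.{u, v} R r) (p k : ℤ) : A.cycles p k →ₗ[R] A.homology p k :=
  Submodule.mkQ _

theorem homologyMk_surjective (A : BigradedComplex.{u, v} R r) (p k : ℤ) :
    Function.Surjective (A.homologyMk p k) :=
  Submodule.Quotient.mk_surjective _

theorem homologyMk_eq_zero (A : BigradedComplex.{u, v} R r) (p k : ℤ) (x : A.cycles p k) :
    A.homologyMk p k x = 0 ↔ (x : A.X p k) ∈ A.boundaries p k :=
  Submodule.Quotient.mk_eq_zero _

theorem mem_cycles (A : BigradedComplex.{u, v} R r) (p k p' k' : ℤ) (hp : p' + r = p)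
    (hk : k + 1 = k') (x : A.X p k) : x ∈ A.cycles p k ↔ A.d p k p' k' hp hk x = 0 := by
  obtain rfl : p' = p - r := by omega
  subst hk
  exact LinearMap.mem_ker

theorem mem_boundaries (A : BigradedComplex.{u, v} R r) (p k p' k' : ℤ) (hp : p' + r = p)
    (hk : k + 1 = k') (x : A.X p' k') :
    x ∈ A.boundaries p' k' ↔ ∃ y : A.X p k, A.d p k p' k' hp hk y = x := by
  subst hp
  obtain rfl : k = k' - 1 := by omega
  exact LinearMap.mem_range

theorem map_mem_cycles {A B : BigradedComplex.{u, v} R r} (f : A ⟶ B) (p k : ℤ)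
    (x : A.X p k) (hx : x ∈ A.cycles p k) : f.f p k x ∈ B.cycles p k := by
  rw [mem_cycles _ p k (p - r) (k + 1) (by omega) rfl] at hx ⊢
  rw [← f.comm, hx, map_zero]

/-- The map induced by a morphism on homology. -/
def homologyMap {A B : BigradedComplex.{u, v} R r} (f : A ⟶ B) (p k : ℤ) :
    A.homology p k →ₗ[R] B.homology p k :=
  Submodule.mapQ _ _ ((f.f p k).restrict (map_mem_cycles f p k)) (by
    rintro ⟨x, hx⟩ ⟨y, hy⟩
    exact ⟨f.f _ _ y, by rw [← f.comm, hy]; rfl⟩)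

end BigradedComplex

/-- Extended spectral sequences: `φ r` is the characteristic map from the page `r + 1` to the
homology of the page `r`. -/
structure ExtSpectralSequence (R : Type u) [CommRing R] where
  page : ∀ r : ℕ, BigradedComplex.{u, v} R r
  φ : ∀ (r : ℕ) (p k : ℤ), (page (r + 1)).X p k →ₗ[R] (page r).homology p k

namespace ExtSpectralSequence

variable {R : Type u} [CommRing R]

/-- Morphisms of extended spectral sequences. -/
@[ext]
structure Hom (X Y : ExtSpectralSequence.{u, v} R) where
  f : ∀ r : ℕ, X.page r ⟶ Y.page r
  comm : ∀ (r : ℕ) (p k : ℤ) (x : (X.page (r + 1)).X p k),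
    BigradedComplex.homologyMap (f r) p k (X.φ r p k x) = Y.φ r p k ((f (r + 1)).f p k x)

instance : Category (ExtSpectralSequence.{u, v} R) where
  Hom X Y := Hom X Y
  id X :=
    { f := fun r => 𝟙 (X.page r)
      comm := fun r p k x => by
        change BigradedComplex.homologyMap (𝟙 _) p k (X.φ r p k x) = X.φ r p k x
        obtain ⟨z, hz⟩ := Submodule.Quotient.mk_surjective _ (X.φ r p k x)
        rw [← hz]
        rfl }
  comp {X Y Z} f g :=
    { f := fun r => f.f r ≫ g.f r
      comm := fun r p k x => by
        have h : BigradedComplex.homologyMap (f.f r ≫ g.f r) p k (X.φ r p k x) =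
            BigradedComplex.homologyMap (g.f r) p k
              (BigradedComplex.homologyMap (f.f r) p k (X.φ r p k x)) := by
          obtain ⟨z, hz⟩ := Submodule.Quotient.mk_surjective _ (X.φ r p k x)
          rw [← hz]
          rfl
        rw [h, f.comm, g.comm]
        rfl }

/-- A spectral sequence is an extended spectral sequence all of whose characteristic maps are
isomorphisms. -/
def IsSpectralSequence (X : ExtSpectralSequence.{u, v} R) : Prop :=
  ∀ (r : ℕ) (p k : ℤ), Function.Bijective (X.φ r p k)

end ExtSpectralSequence

/-- The category of spectral sequences, a full subcategory of the category of extended spectral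
sequences. -/
abbrev SpecSeq (R : Type u) [CommRing R] :=
  ObjectProperty.FullSubcategory (C := ExtSpectralSequence.{u, v} R)
    ExtSpectralSequence.IsSpectralSequence

/-!
### Linear witness books, the functors `𝒩` and `𝒬`, and décalage of spectral sequences
-/

/-- Linear witness books: `w r` is the witness map from the page `r + 1` to the page `r`, of
bidegree `(0, 0)`, and `s r` is the degeneracy map from the page `r` to the page `r + 1`, of
bidegree `(1, 1)`. -/
structure LinearWitnessBook (R : Type u) [CommRing R] where
  page : ∀ r : ℕ, BigradedComplex.{u, v} R r
  w : ∀ (r : ℕ) (p k : ℤ), (page (r + 1)).X p k →ₗ[R] (page r).X p k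
  s : ∀ (r : ℕ) (p k p' : ℤ), p + 1 = p' → ((page r).X p k →ₗ[R] (page (r + 1)).X p' k)
  w_s : ∀ (r : ℕ) (p k p' : ℤ) (hp : p + 1 = p') (x : (page r).X p k),
    w r p' k (s r p k p' hp x) = 0
  s_w : ∀ (r : ℕ) (p k p' : ℤ) (hp : p + 1 = p') (x : (page (r + 1)).X p k),
    s r p k p' hp (w r p k x) = 0
  w_d_s : ∀ (r : ℕ) (p k p₁ p' k' : ℤ) (h₁ : p + 1 = p₁) (hp : p' + r = p)
    (hp' : p' + (r + 1 : ℕ) = p₁) (hk : k + 1 = k') (x : (page r).X p k),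
    w r p' k' ((page (r + 1)).d p₁ k p' k' hp' hk (s r p k p₁ h₁ x)) =
      (page r).d p k p' k' hp hk x

namespace LinearWitnessBook

variable {R : Type u} [CommRing R]

/-- Morphisms of linear witness books. -/
@[ext]
structure Hom (L M : LinearWitnessBook.{u, v} R) where
  f : ∀ r : ℕ, L.page r ⟶ M.page r
  comm_w : ∀ (r : ℕ) (p k : ℤ) (x : (L.page (r + 1)).X p k),
    (f r).f p k (L.w r p k x) = M.w r p k ((f (r + 1)).f p k x)
  comm_s : ∀ (r : ℕ) (p k p' : ℤ) (hp : p + 1 = p') (x : (L.page r).X p k),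
    (f (r + 1)).f p' k (L.s r p k p' hp x) = M.s r p k p' hp ((f r).f p k x)

instance : Category (LinearWitnessBook.{u, v} R) where
  Hom L M := Hom L M
  id L :=
    { f := fun r => 𝟙 (L.page r)
      comm_w := fun _ _ _ _ => rfl
      comm_s := fun _ _ _ _ _ _ => rfl }
  comp {L M N} f g :=
    { f := fun r => f.f r ≫ g.f r
      comm_w := fun r p k x => by
        change (g.f r).f p k ((f.f r).f p k _) = N.w r p k ((g.f (r + 1)).f p k _)
        rw [f.comm_w, g.comm_w]
      comm_s := fun r p k p' hp x => by
        change (g.f (r + 1)).f p' k ((f.f (r + 1)).f p' k _) =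
          N.s r p k p' hp ((g.f r).f p k _)
        rw [f.comm_s, g.comm_s] }

theorem d_w (L : LinearWitnessBook.{u, v} R) (r : ℕ) (p k p' k' : ℤ) (hp : p' + r = p)
    (hk : k + 1 = k') (x : (L.page (r + 1)).X p k) :
    (L.page r).d p k p' k' hp hk (L.w r p k x) = 0 := by
  rw [← L.w_d_s r p k (p + 1) p' k' rfl hp (by push_cast; omega) hk, L.s_w, map_zero, map_zero]

/-- Forget the page `0` and translate all other pages one page down, that is, apply `𝒯⁻¹`,
where `(𝒯⁻¹ A)^{p,n} = A^{2p-n,p}`. -/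
def turnObj (L : LinearWitnessBook.{u, v} R) : LinearWitnessBook.{u, v} R where
  page r :=
    { X := fun p k => (L.page (r + 1)).X (p - k) k
      d := fun p k p' k' hp hk =>
        (L.page (r + 1)).d (p - k) k (p' - k') k' (by push_cast; omega) hk
      d_d := fun p k p' k' p'' k'' hp hk hp' hk' x => (L.page (r + 1)).d_d _ _ _ _ _ _ _ _ _ _ x }
  w r p k := L.w (r + 1) (p - k) k
  s r p k p' hp := L.s (r + 1) (p - k) k (p' - k) (by omega)
  w_s r p k p' hp x := L.w_s (r + 1) _ _ _ _ x
  s_w r p k p' hp x := L.s_w (r + 1) _ _ _ _ x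
  w_d_s r p k p₁ p' k' h₁ hp hp' hk x :=
    L.w_d_s (r + 1) _ _ _ _ _ (by omega) (by push_cast; omega) (by push_cast; omega) hk x

/-- The functor `𝒯⁻¹ ∘ 𝒰_{≥ 1}` on linear witness books. -/
def turn (R : Type u) [CommRing R] :
    LinearWitnessBook.{u, v} R ⥤ LinearWitnessBook.{u, v} R where
  obj L := L.turnObj
  map f :=
    { f := fun r =>
        { f := fun p k => (f.f (r + 1)).f (p - k) k
          comm := fun p k p' k' hp hk x => (f.f (r + 1)).comm _ _ _ _ _ _ x }
      comm_w := fun r p k x => f.comm_w (r + 1) _ _ x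
      comm_s := fun r p k p' hp x => f.comm_s (r + 1) _ _ _ _ x }

/-- The subcomplexes `S_0 = 0` and `S_{r+1} = s_r L_r + d_{r+1} s_r L_r` of the pages of `L`. -/
def degen (L : LinearWitnessBook.{u, v} R) :
    ∀ (r : ℕ) (p k : ℤ), Submodule R ((L.page r).X p k)
  | 0, _, _ => ⊥
  | r + 1, p, k =>
    LinearMap.range (L.s r (p - 1) k p (by omega)) ⊔
      (LinearMap.range (L.s r (p + r) (k - 1) (p + (r + 1 : ℕ)) (by push_cast; omega))).map
        ((L.page (r + 1)).d (p + (r + 1 : ℕ)) (k - 1) p k rfl (by omega))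

theorem mem_degen_succ (L : LinearWitnessBook.{u, v} R) (r : ℕ) (p k p₁ p₂ p₃ k' : ℤ)
    (h₁ : p₁ + 1 = p) (h₂ : p₂ + 1 = p₃) (h₃ : p + (r + 1 : ℕ) = p₃) (hk : k' + 1 = k)
    (x : (L.page (r + 1)).X p k) :
    x ∈ L.degen (r + 1) p k ↔ ∃ (a : (L.page r).X p₁ k) (b : (L.page r).X p₂ k'),
      L.s r p₁ k p h₁ a + (L.page (r + 1)).d p₃ k' p k h₃ hk (L.s r p₂ k' p₃ h₂ b) = x := by
  obtain rfl : p₁ = p - 1 := by omega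
  obtain rfl : k' = k - 1 := by omega
  obtain rfl : p₂ = p + r := by push_cast at h₃; omega
  subst h₃
  simp [degen, Submodule.mem_sup]

theorem d_mem_degen (L : LinearWitnessBook.{u, v} R) (r : ℕ) (p k p' k' : ℤ) (hp : p' + r = p)
    (hk : k + 1 = k') (x : (L.page r).X p k) (hx : x ∈ L.degen r p k) :
    (L.page r).d p k p' k' hp hk x ∈ L.degen r p' k' := by
  cases r with
  | zero =>
    rw [show x = 0 from hx, map_zero]
    exact Submodule.zero_mem _
  | succ r =>
    obtain ⟨a, b, rfl⟩ := (L.mem_degen_succ r p k (p - 1) (p + r) (p + (r + 1 : ℕ)) (k - 1)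
      (by omega) (by push_cast; omega) rfl (by omega) x).1 hx
    rw [L.mem_degen_succ r p' k' (p' - 1) (p - 1) p k (by omega) (by omega) hp hk]
    exact ⟨0, a, by rw [map_zero, map_add, (L.page (r + 1)).d_d, zero_add, add_zero]⟩

theorem map_mem_degen {L M : LinearWitnessBook.{u, v} R} (f : L ⟶ M) (r : ℕ) (p k : ℤ)
    (x : (L.page r).X p k) (hx : x ∈ L.degen r p k) : (f.f r).f p k x ∈ M.degen r p k := by
  cases r with
  | zero =>
    rw [show x = 0 from hx, map_zero]
    exact Submodule.zero_mem _
  | succ r =>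
    obtain ⟨a, b, rfl⟩ := (L.mem_degen_succ r p k (p - 1) (p + r) (p + (r + 1 : ℕ)) (k - 1)
      (by omega) (by push_cast; omega) rfl (by omega) x).1 hx
    rw [M.mem_degen_succ r p k (p - 1) (p + r) (p + (r + 1 : ℕ)) (k - 1)
      (by omega) (by push_cast; omega) rfl (by omega)]
    exact ⟨(f.f r).f _ _ a, (f.f r).f _ _ b, by
      rw [map_add, (f.f (r + 1)).comm, f.comm_s, f.comm_s]⟩

/-- The `r`-bigraded complex `L_r / S_r`. -/
def quotPage (L : LinearWitnessBook.{u, v} R) (r : ℕ) : BigradedComplex.{u, v} R r where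
  X p k := ModuleCat.of R ((L.page r).X p k ⧸ L.degen r p k)
  d p k p' k' hp hk := Submodule.mapQ _ _ ((L.page r).d p k p' k' hp hk)
    (fun x hx => L.d_mem_degen r p k p' k' hp hk x hx)
  d_d p k p' k' p'' k'' hp hk hp' hk' x := by
    obtain ⟨x, rfl⟩ := Submodule.Quotient.mk_surjective _ x
    change Submodule.Quotient.mk _ = _
    rw [(L.page r).d_d]
    rfl

/-- The quotient map `L_r → L_r / S_r`. -/
def quotMk (L : LinearWitnessBook.{u, v} R) (r : ℕ) (p k : ℤ) :
    (L.page r).X p k →ₗ[R] (L.quotPage r).X p k :=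
  Submodule.mkQ _

theorem quotMk_surjective (L : LinearWitnessBook.{u, v} R) (r : ℕ) (p k : ℤ) :
    Function.Surjective (L.quotMk r p k) :=
  Submodule.Quotient.mk_surjective _

theorem quotMk_eq_zero (L : LinearWitnessBook.{u, v} R) (r : ℕ) (p k : ℤ)
    (x : (L.page r).X p k) : L.quotMk r p k x = 0 ↔ x ∈ L.degen r p k :=
  Submodule.Quotient.mk_eq_zero _

theorem quotPage_d_mk (L : LinearWitnessBook.{u, v} R) (r : ℕ) (p k p' k' : ℤ) (hp : p' + r = p)
    (hk : k + 1 = k') (x : (L.page r).X p k) :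
    (L.quotPage r).d p k p' k' hp hk (L.quotMk r p k x) =
      L.quotMk r p' k' ((L.page r).d p k p' k' hp hk x) :=
  rfl

theorem quotMk_w_mem_cycles (L : LinearWitnessBook.{u, v} R) (r : ℕ) (p k : ℤ)
    (x : (L.page (r + 1)).X p k) : L.quotMk r p k (L.w r p k x) ∈ (L.quotPage r).cycles p k := by
  rw [BigradedComplex.mem_cycles _ p k (p - r) (k + 1) (by omega) rfl, quotPage_d_mk, L.d_w,
    map_zero]

/-- The extended spectral sequence `𝒬(L)`, with pages `L_r / S_r` (so that its page `0` is `L_0`)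
and with the characteristic maps that send the class of `a` to the class of `w a`. -/
def quotObj (L : LinearWitnessBook.{u, v} R) : ExtSpectralSequence.{u, v} R where
  page := L.quotPage
  φ r p k := Submodule.liftQ (L.degen (r + 1) p k)
    (((L.quotPage r).homologyMk p k).comp
      (((L.quotMk r p k).comp (L.w r p k)).codRestrict _ (L.quotMk_w_mem_cycles r p k)))
    (by
      intro x hx
      obtain ⟨a, b, rfl⟩ := (L.mem_degen_succ r p k (p - 1) (p + r) (p + (r + 1 : ℕ)) (k - 1)
        (by omega) (by push_cast; omega) rfl (by omega) x).1 hx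
      refine (Submodule.Quotient.mk_eq_zero _).2 ?_
      refine (BigradedComplex.mem_boundaries _ (p + r) (k - 1) p k rfl (by omega) _).2
        ⟨L.quotMk r _ _ b, ?_⟩
      rw [quotPage_d_mk]
      change _ = L.quotMk r p k (L.w r p k _)
      rw [map_add, L.w_s, zero_add, L.w_d_s r (p + r) (k - 1) _ p k _ rfl])

/-- The functor `𝒬` from linear witness books to extended spectral sequences. -/
def quot (R : Type u) [CommRing R] :
    LinearWitnessBook.{u, v} R ⥤ ExtSpectralSequence.{u, v} R where
  obj L := L.quotObj
  map {L M} f :=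
    { f := fun r =>
        { f := fun p k => Submodule.mapQ (L.degen r p k) (M.degen r p k) ((f.f r).f p k)
            (map_mem_degen f r p k)
          comm := fun p k p' k' hp hk x => by
            obtain ⟨x, rfl⟩ := L.quotMk_surjective r p k x
            change M.quotMk r p' k' _ = M.quotMk r p' k' _
            rw [(f.f r).comm] }
      comm := fun r p k x => by
        obtain ⟨x, rfl⟩ := L.quotMk_surjective (r + 1) p k x
        change (M.quotPage r).homologyMk p k ⟨M.quotMk r p k ((f.f r).f p k (L.w r p k x)), _⟩ =
          (M.quotPage r).homologyMk p k ⟨M.quotMk r p k (M.w r p k ((f.f (r + 1)).f p k x)), _⟩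
        congr 3
        exact f.comm_w r p k x }
  map_id L := by
    refine ExtSpectralSequence.Hom.ext (funext fun r => BigradedComplex.Hom.ext ?_)
    refine funext fun p => funext fun k => LinearMap.ext fun x => ?_
    obtain ⟨x, rfl⟩ := L.quotMk_surjective r p k x
    rfl
  map_comp {L M N} f g := by
    refine ExtSpectralSequence.Hom.ext (funext fun r => BigradedComplex.Hom.ext ?_)
    refine funext fun p => funext fun k => LinearMap.ext fun x => ?_
    obtain ⟨x, rfl⟩ := L.quotMk_surjective r p k x
    rfl

theorem quotObj_φ_mk (L : LinearWitnessBook.{u, v} R) (r : ℕ) (p k : ℤ)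
    (x : (L.page (r + 1)).X p k) :
    L.quotObj.φ r p k (L.quotMk (r + 1) p k x) =
      (L.quotPage r).homologyMk p k ⟨L.quotMk r p k (L.w r p k x), L.quotMk_w_mem_cycles r p k x⟩ :=
  rfl

/-- The condition `Im w = Ker d = Ker s`, `Ker w = Im s`. -/
structure IsSpectral (L : LinearWitnessBook.{u, v} R) : Prop where
  s_eq_zero : ∀ (r : ℕ) (p k p' k' p₁ : ℤ) (hp : p' + r = p) (hk : k + 1 = k') (h₁ : p + 1 = p₁)
    (x : (L.page r).X p k), (L.page r).d p k p' k' hp hk x = 0 → L.s r p k p₁ h₁ x = 0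
  exists_w : ∀ (r : ℕ) (p k p' k' : ℤ) (hp : p' + r = p) (hk : k + 1 = k')
    (x : (L.page r).X p k), (L.page r).d p k p' k' hp hk x = 0 → ∃ y, L.w r p k y = x
  exists_s : ∀ (r : ℕ) (p k p' : ℤ) (hp : p' + 1 = p) (x : (L.page (r + 1)).X p k),
    L.w r p k x = 0 → ∃ y, L.s r p' k p hp y = x

theorem IsSpectral.turn {L : LinearWitnessBook.{u, v} R} (h : L.IsSpectral) :
    L.turnObj.IsSpectral where
  s_eq_zero r p k p' k' p₁ hp hk h₁ x hx :=
    h.s_eq_zero (r + 1) (p - k) k (p' - k') k' (p₁ - k) (by push_cast; omega) hk (by omega) x hx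
  exists_w r p k p' k' hp hk x hx :=
    h.exists_w (r + 1) (p - k) k (p' - k') k' (by push_cast; omega) hk x hx
  exists_s r p k p' hp x hx := h.exists_s (r + 1) (p - k) k (p' - k) (by omega) x hx

theorem IsSpectral.quot {L : LinearWitnessBook.{u, v} R} (h : L.IsSpectral) :
    L.quotObj.IsSpectralSequence := by
  -- a cycle of the form `s b` vanishes
  have key : ∀ (r : ℕ) (p k p₁ p' k' : ℤ) (h₁ : p + 1 = p₁) (hp' : p' + (r + 1 : ℕ) = p₁)
      (hk : k + 1 = k') (b : (L.page r).X p k),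
      (L.page (r + 1)).d p₁ k p' k' hp' hk (L.s r p k p₁ h₁ b) = 0 → L.s r p k p₁ h₁ b = 0 := by
    intro r p k p₁ p' k' h₁ hp' hk b hb
    refine h.s_eq_zero r p k p' k' p₁ (by push_cast at hp'; omega) hk h₁ b ?_
    rw [← L.w_d_s r p k p₁ p' k' h₁ _ hp' hk, hb, map_zero]
  intro r p k
  constructor
  · rw [injective_iff_map_eq_zero]
    intro x hx
    obtain ⟨x, rfl⟩ := L.quotMk_surjective (r + 1) p k x
    rw [quotObj_φ_mk] at hx
    have hx' := (BigradedComplex.mem_boundaries _ (p + r) (k - 1) p k rfl (by omega) _).1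
      (((L.quotPage r).homologyMk_eq_zero p k _).1 hx)
    obtain ⟨e, he⟩ := hx'
    obtain ⟨e, rfl⟩ := L.quotMk_surjective r _ _ e
    change _ = L.quotMk r p k (L.w r p k x) at he
    rw [quotPage_d_mk, ← sub_eq_zero, ← map_sub, quotMk_eq_zero] at he
    have : ∃ c : (L.page r).X (p + r) (k - 1),
        (L.page r).d (p + r) (k - 1) p k rfl (by omega) c = L.w r p k x := by
      cases r with
      | zero => exact ⟨e, sub_eq_zero.1 he⟩
      | succ r =>
        obtain ⟨a, b, hab⟩ := (L.mem_degen_succ r p k (p - 1) (p + r) (p + (r + 1 : ℕ)) (k - 1)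
          (by omega) (by push_cast; omega) rfl (by omega) _).1 he
        have ha : L.s r (p - 1) k p (by omega) a = 0 := by
          refine key r (p - 1) k p (p - (r + 1 : ℕ)) (k + 1) (by omega) (by omega) rfl a ?_
          have := congrArg ((L.page (r + 1)).d p k (p - (r + 1 : ℕ)) (k + 1) (by omega) rfl) hab
          rw [map_add, map_sub, (L.page (r + 1)).d_d, (L.page (r + 1)).d_d, L.d_w] at this
          simpa using this
        refine ⟨e - L.s r (p + r) (k - 1) _ (by push_cast; omega) b, ?_⟩
        rw [ha, zero_add] at hab
        rw [map_sub, hab]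
        abel
    obtain ⟨c, hc⟩ := this
    refine (L.quotMk_eq_zero (r + 1) p k x).2 ?_
    rw [L.mem_degen_succ r p k (p - 1) (p + r) (p + (r + 1 : ℕ)) (k - 1)
      (by omega) (by push_cast; omega) rfl (by omega)]
    obtain ⟨y, hy⟩ := h.exists_s r p k (p - 1) (by omega) (x -
      (L.page (r + 1)).d (p + (r + 1 : ℕ)) (k - 1) p k rfl (by omega)
        (L.s r (p + r) (k - 1) (p + (r + 1 : ℕ)) (by push_cast; omega) c))
      (by rw [map_sub, L.w_d_s r (p + r) (k - 1) _ p k _ rfl, hc, sub_self])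
    exact ⟨y, c, by rw [hy, sub_add_cancel]⟩
  · intro x
    obtain ⟨⟨x, hx⟩, rfl⟩ := (L.quotPage r).homologyMk_surjective p k x
    obtain ⟨x, rfl⟩ := L.quotMk_surjective r p k x
    have hx' := hx
    rw [BigradedComplex.mem_cycles _ p k (p - r) (k + 1) (by omega) rfl] at hx'
    change (L.quotPage r).d _ _ _ _ _ _ (L.quotMk r p k x) = 0 at hx'
    rw [quotPage_d_mk, quotMk_eq_zero] at hx'
    have : ∃ x', L.quotMk r p k x' = L.quotMk r p k x ∧
        (L.page r).d p k (p - r) (k + 1) (by omega) rfl x' = 0 := by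
      cases r with
      | zero => exact ⟨x, rfl, hx'⟩
      | succ r =>
        obtain ⟨a, b, hab⟩ := (L.mem_degen_succ r _ _ (p - (r + 1 : ℕ) - 1) (p - 1) p k
          (by omega) (by omega) (by omega) rfl _).1 hx'
        have ha : L.s r _ _ (p - (r + 1 : ℕ)) (by omega) a = 0 := by
          refine key r _ _ _ (p - (r + 1 : ℕ) - (r + 1 : ℕ)) (k + 1 + 1) (by omega) (by omega)
            rfl a ?_
          have := congrArg ((L.page (r + 1)).d (p - (r + 1 : ℕ)) (k + 1)
            (p - (r + 1 : ℕ) - (r + 1 : ℕ)) (k + 1 + 1) (by omega) rfl) hab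
          rw [map_add, (L.page (r + 1)).d_d, (L.page (r + 1)).d_d] at this
          simpa using this
        rw [ha, zero_add] at hab
        refine ⟨x - L.s r (p - 1) k p (by omega) b, ?_, by rw [map_sub, hab, sub_self]⟩
        rw [← sub_eq_zero, ← map_sub, quotMk_eq_zero,
          L.mem_degen_succ r p k (p - 1) (p + r) (p + (r + 1 : ℕ)) (k - 1)
            (by omega) (by push_cast; omega) rfl (by omega)]
        exact ⟨-b, 0, by simp⟩
    obtain ⟨x', h1, h2⟩ := this
    obtain ⟨y, hy⟩ := h.exists_w r p k (p - r) (k + 1) (by omega) rfl x' h2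
    refine ⟨L.quotMk (r + 1) p k y, ?_⟩
    rw [quotObj_φ_mk]
    change (L.quotPage r).homologyMk p k _ = (L.quotPage r).homologyMk p k _
    congr 1
    exact Subtype.ext ((congrArg _ hy).trans h1)

end LinearWitnessBook

namespace ExtSpectralSequence

variable {R : Type u} [CommRing R]

/-- The one-point type of target degrees `(p - r, k + 1)` of the differential from `(p, k)` on an
`r`-bigraded complex. -/
abbrev Target (r : ℕ) (p k : ℤ) : Type :=
  {q : ℤ × ℤ // q.1 + r = p ∧ k + 1 = q.2}

/-- `a` is a cycle of the page `i`, and the characteristic map sends `b` to its class. -/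
def Lifts (X : ExtSpectralSequence.{u, v} R) (i : ℕ) (p k : ℤ) (a : (X.page i).X p k)
    (b : (X.page (i + 1)).X p k) : Prop :=
  ∃ h : a ∈ (X.page i).cycles p k, X.φ i p k b = (X.page i).homologyMk p k ⟨a, h⟩

theorem Lifts.zero (X : ExtSpectralSequence.{u, v} R) (i : ℕ) (p k : ℤ) :
    X.Lifts i p k 0 0 :=
  ⟨Submodule.zero_mem _, by rw [map_zero]; exact (map_zero _).symm⟩

theorem Lifts.add {X : ExtSpectralSequence.{u, v} R} {i : ℕ} {p k : ℤ} {a a' : (X.page i).X p k}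
    {b b' : (X.page (i + 1)).X p k} (h : X.Lifts i p k a b) (h' : X.Lifts i p k a' b') :
    X.Lifts i p k (a + a') (b + b') := by
  obtain ⟨h, e⟩ := h
  obtain ⟨h', e'⟩ := h'
  exact ⟨Submodule.add_mem _ h h', by rw [map_add, e, e', ← map_add]; rfl⟩

theorem Lifts.smul {X : ExtSpectralSequence.{u, v} R} {i : ℕ} {p k : ℤ} {a : (X.page i).X p k}
    {b : (X.page (i + 1)).X p k} (c : R) (h : X.Lifts i p k a b) :
    X.Lifts i p k (c • a) (c • b) := by
  obtain ⟨h, e⟩ := h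
  exact ⟨Submodule.smul_mem _ c h, by rw [map_smul, e, ← map_smul]; rfl⟩

theorem Lifts.map {X Y : ExtSpectralSequence.{u, v} R} (f : X ⟶ Y) {i : ℕ} {p k : ℤ}
    {a : (X.page i).X p k} {b : (X.page (i + 1)).X p k} (h : X.Lifts i p k a b) :
    Y.Lifts i p k ((f.f i).f p k a) ((f.f (i + 1)).f p k b) := by
  obtain ⟨h, e⟩ := h
  exact ⟨BigradedComplex.map_mem_cycles _ _ _ _ h, by rw [← f.comm, e]; rfl⟩

theorem exists_lifts (X : ExtSpectralSequence.{u, v} R) (r : ℕ) (p k : ℤ) (c : (X.page r).X p k) :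
    ∃ x : ∀ i : ℕ, (X.page i).X p k, x r = c ∧ ∀ i < r, X.Lifts i p k (x i) (x (i + 1)) := by
  induction r with
  | zero => exact ⟨Function.update (fun _ => 0) 0 c, by simp, by simp⟩
  | succ r ih =>
    obtain ⟨⟨a, ha⟩, e⟩ := (X.page r).homologyMk_surjective p k (X.φ r p k c)
    obtain ⟨x, hx, hl⟩ := ih a
    refine ⟨Function.update x (r + 1) c, by simp, fun i hi => ?_⟩
    rw [Function.update_of_ne (by omega : i ≠ r + 1)]
    rcases Nat.lt_succ_iff_lt_or_eq.1 hi with hi | rfl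
    · rw [Function.update_of_ne (by omega : i + 1 ≠ r + 1)]
      exact hl i hi
    · rw [Function.update_self, hx]
      exact ⟨ha, e.symm⟩

/-- `(x_0, …, x_r)` is a compatible sequence in degree `(p, k)`. -/
def IsCompatible (X : ExtSpectralSequence.{u, v} R) (r : ℕ) (p k : ℤ)
    (x : ∀ i : Fin (r + 1), (X.page i).X p k) : Prop :=
  ∀ (i : ℕ) (h : i < r), X.Lifts i p k (x ⟨i, by omega⟩) (x ⟨i + 1, by omega⟩)

/-- The families in which the elements of `𝒩(X)_r` of degree `(p, k)` live. -/
abbrev NerveAmbient (X : ExtSpectralSequence.{u, v} R) (r : ℕ) (p k : ℤ) : Type v :=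
  (∀ i : Fin (r + 1), (X.page i).X p k) ×
    (∀ (i : Fin (r + 1)) (q : Target r p k), (X.page i).X q.1.1 q.1.2)

/-- `(x_0, …, x_r; y_0, …, y_r)` is a pair of compatible sequences, in the degrees `(p, k)` and
`(p - r, k + 1)`, such that `d x_r = y_r`. -/
def IsNerve (X : ExtSpectralSequence.{u, v} R) (r : ℕ) (p k : ℤ) (z : X.NerveAmbient r p k) :
    Prop :=
  X.IsCompatible r p k z.1 ∧ ∀ q : Target r p k,
    X.IsCompatible r q.1.1 q.1.2 (fun i => z.2 i q) ∧
      (X.page r).d p k q.1.1 q.1.2 q.2.1 q.2.2 (z.1 ⟨r, by omega⟩) = z.2 ⟨r, by omega⟩ q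

/-- The module `𝒩(X)_r` in degree `(p, k)`. -/
def nerveModule (X : ExtSpectralSequence.{u, v} R) (r : ℕ) (p k : ℤ) :
    Submodule R (X.NerveAmbient r p k) where
  carrier := {z | X.IsNerve r p k z}
  zero_mem' := ⟨fun i _ => Lifts.zero X i p k, fun q => ⟨fun i _ => Lifts.zero X i _ _,
    map_zero _⟩⟩
  add_mem' {z z'} hz hz' := ⟨fun i h => (hz.1 i h).add (hz'.1 i h), fun q =>
    ⟨fun i h => ((hz.2 q).1 i h).add ((hz'.2 q).1 i h), by
      change (X.page r).d p k q.1.1 q.1.2 q.2.1 q.2.2 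
        (z.1 ⟨r, r.lt_succ_self⟩ + z'.1 ⟨r, r.lt_succ_self⟩) =
        z.2 ⟨r, r.lt_succ_self⟩ q + z'.2 ⟨r, r.lt_succ_self⟩ q
      rw [map_add, (hz.2 q).2, (hz'.2 q).2]⟩⟩
  smul_mem' c z hz := ⟨fun i h => (hz.1 i h).smul c, fun q =>
    ⟨fun i h => ((hz.2 q).1 i h).smul c, by
      change (X.page r).d p k q.1.1 q.1.2 q.2.1 q.2.2 (c • z.1 ⟨r, by omega⟩) =
        c • z.2 ⟨r, by omega⟩ q
      rw [map_smul, (hz.2 q).2]⟩⟩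

theorem nerve_ext {X : ExtSpectralSequence.{u, v} R} {r : ℕ} {p k : ℤ}
    {z z' : X.nerveModule r p k} (h₁ : ∀ i, z.1.1 i = z'.1.1 i)
    (h₂ : ∀ i q, z.1.2 i q = z'.1.2 i q) : z = z' :=
  Subtype.ext (Prod.ext (funext h₁) (funext fun i => funext (h₂ i)))

/-- `d (x; y) = (y; 0)`. -/
def nerveD (X : ExtSpectralSequence.{u, v} R) (r : ℕ) (p k p' k' : ℤ) (hp : p' + r = p)
    (hk : k + 1 = k') : X.nerveModule r p k →ₗ[R] X.nerveModule r p' k' where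
  toFun z := ⟨(fun i => z.1.2 i ⟨(p', k'), hp, hk⟩, fun _ _ => 0),
    (z.2.2 ⟨(p', k'), hp, hk⟩).1, fun q => ⟨fun i _ => Lifts.zero X i _ _, by
      change (X.page r).d p' k' q.1.1 q.1.2 q.2.1 q.2.2
        (z.1.2 ⟨r, by omega⟩ ⟨(p', k'), hp, hk⟩) = 0
      rw [← (z.2.2 ⟨(p', k'), hp, hk⟩).2, (X.page r).d_d]⟩⟩
  map_add' _ _ := nerve_ext (fun _ => rfl) (fun i q =>
    (add_zero (0 : (X.page i).X q.1.1 q.1.2)).symm)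
  map_smul' c _ := nerve_ext (fun _ => rfl) (fun i q =>
    (smul_zero (A := (X.page i).X q.1.1 q.1.2) c).symm)

/-- `w (x; y) = (x_0, …, x_r; 0)` for `(x; y)` in `𝒩(X)_{r+1}`. -/
def nerveW (X : ExtSpectralSequence.{u, v} R) (r : ℕ) (p k : ℤ) :
    X.nerveModule (r + 1) p k →ₗ[R] X.nerveModule r p k where
  toFun z := ⟨(fun i => z.1.1 ⟨i, by omega⟩, fun _ _ => 0),
    fun i h => z.2.1 i (by omega), fun q => ⟨fun i _ => Lifts.zero X i _ _, by
      obtain ⟨h, -⟩ := z.2.1 r (by omega)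
      exact ((X.page r).mem_cycles p k q.1.1 q.1.2 q.2.1 q.2.2 _).1 h⟩⟩
  map_add' _ _ := nerve_ext (fun _ => rfl) (fun i q =>
    (add_zero (0 : (X.page i).X q.1.1 q.1.2)).symm)
  map_smul' c _ := nerve_ext (fun _ => rfl) (fun i q =>
    (smul_zero (A := (X.page i).X q.1.1 q.1.2) c).symm)

/-- The targets of the differentials from `(p, k)` on the page `r` and from `(p + 1, k)` on the
page `r + 1` agree. -/
abbrev Target.ofSucc {r : ℕ} {p k p' : ℤ} (hp : p + 1 = p') (q : Target (r + 1) p' k) :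
    Target r p k :=
  ⟨q.1, by have := q.2.1; push_cast at this; omega, q.2.2⟩

/-- The sequence `(y_0, …, y_r, 0)`. -/
def extendByZero (X : ExtSpectralSequence.{u, v} R) (r : ℕ) (p k : ℤ)
    (y : ∀ i : Fin (r + 1), (X.page i).X p k) (i : Fin (r + 1 + 1)) : (X.page i).X p k :=
  if h : (i : ℕ) < r + 1 then y ⟨i, h⟩ else 0

theorem extendByZero_of_lt (X : ExtSpectralSequence.{u, v} R) (r : ℕ) (p k : ℤ)
    (y : ∀ i : Fin (r + 1), (X.page i).X p k) (i : Fin (r + 1 + 1)) (h : (i : ℕ) < r + 1) :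
    X.extendByZero r p k y i = y ⟨i, h⟩ :=
  dif_pos h

theorem extendByZero_last (X : ExtSpectralSequence.{u, v} R) (r : ℕ) (p k : ℤ)
    (y : ∀ i : Fin (r + 1), (X.page i).X p k) :
    X.extendByZero r p k y ⟨r + 1, by omega⟩ = 0 :=
  dif_neg (by simp)

theorem extendByZero_zero (X : ExtSpectralSequence.{u, v} R) (r : ℕ) (p k : ℤ)
    (i : Fin (r + 1 + 1)) : X.extendByZero r p k (fun _ => 0) i = 0 := by
  unfold extendByZero
  split_ifs <;> rfl

theorem extendByZero_add (X : ExtSpectralSequence.{u, v} R) (r : ℕ) (p k : ℤ)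
    (y y' : ∀ i : Fin (r + 1), (X.page i).X p k) (i : Fin (r + 1 + 1)) :
    X.extendByZero r p k (fun j => y j + y' j) i =
      X.extendByZero r p k y i + X.extendByZero r p k y' i := by
  unfold extendByZero
  split_ifs
  · rfl
  · exact (add_zero _).symm

theorem extendByZero_smul (X : ExtSpectralSequence.{u, v} R) (r : ℕ) (p k : ℤ) (c : R)
    (y : ∀ i : Fin (r + 1), (X.page i).X p k) (i : Fin (r + 1 + 1)) :
    X.extendByZero r p k (fun j => c • y j) i = c • X.extendByZero r p k y i := by
  unfold extendByZero
  split_ifs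
  · rfl
  · exact (smul_zero _).symm

theorem extendByZero_map {X Y : ExtSpectralSequence.{u, v} R} (f : X ⟶ Y) (r : ℕ) (p k : ℤ)
    (y : ∀ i : Fin (r + 1), (X.page i).X p k) (i : Fin (r + 1 + 1)) :
    (f.f i).f p k (X.extendByZero r p k y i) =
      Y.extendByZero r p k (fun j => (f.f j).f p k (y j)) i := by
  unfold extendByZero
  split_ifs
  · rfl
  · exact map_zero _

theorem extendByZero_compatible (X : ExtSpectralSequence.{u, v} R) (r : ℕ) (p k : ℤ)
    (y : ∀ i : Fin (r + 1), (X.page i).X p k) (hy : X.IsCompatible r p k y)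
    (hb : y ⟨r, by omega⟩ ∈ (X.page r).boundaries p k) :
    X.IsCompatible (r + 1) p k (X.extendByZero r p k y) := by
  intro i h
  rw [X.extendByZero_of_lt r p k y ⟨i, by omega⟩ h]
  by_cases h' : i < r
  · rw [X.extendByZero_of_lt r p k y ⟨i + 1, by omega⟩ (by dsimp only; omega)]
    exact hy i h'
  · obtain rfl : i = r := by omega
    rw [X.extendByZero_last]
    have hc : y ⟨i, by omega⟩ ∈ (X.page i).cycles p k := by
      obtain ⟨c, hc⟩ := ((X.page i).mem_boundaries (p + i) (k - 1) p k rfl (by omega) _).1 hb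
      rw [← hc, (X.page i).mem_cycles _ _ (p - i) (k + 1) (by omega) rfl, (X.page i).d_d]
    exact ⟨hc, (map_zero _).trans (((X.page i).homologyMk_eq_zero p k ⟨_, hc⟩).2 hb).symm⟩

/-- `s (x; y) = (0; y_0, …, y_r, 0)`. -/
def nerveS (X : ExtSpectralSequence.{u, v} R) (r : ℕ) (p k p' : ℤ) (hp : p + 1 = p') :
    X.nerveModule r p k →ₗ[R] X.nerveModule (r + 1) p' k where
  toFun z := ⟨(fun _ => 0, fun i q =>
      X.extendByZero r q.1.1 q.1.2 (fun j => z.1.2 j (Target.ofSucc hp q)) i),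
    fun i _ => Lifts.zero X i _ _, fun q =>
      ⟨X.extendByZero_compatible r q.1.1 q.1.2 (fun j => z.1.2 j (Target.ofSucc hp q))
        (z.2.2 (Target.ofSucc hp q)).1
        (((X.page r).mem_boundaries p k q.1.1 q.1.2 (Target.ofSucc hp q).2.1 q.2.2 _).2
          ⟨_, (z.2.2 (Target.ofSucc hp q)).2⟩),
       (map_zero _).trans (X.extendByZero_last r q.1.1 q.1.2
         (fun j => z.1.2 j (Target.ofSucc hp q))).symm⟩⟩
  map_add' z z' := nerve_ext (fun i => (add_zero (0 : (X.page i).X p' k)).symm)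
    (fun i q => X.extendByZero_add r q.1.1 q.1.2 (fun j => z.1.2 j (Target.ofSucc hp q))
      (fun j => z'.1.2 j (Target.ofSucc hp q)) i)
  map_smul' c z := nerve_ext (fun i => (smul_zero (A := (X.page i).X p' k) c).symm)
    (fun i q => X.extendByZero_smul r q.1.1 q.1.2 c (fun j => z.1.2 j (Target.ofSucc hp q)) i)

/-- The linear witness book `𝒩(X)`. -/
def nerveObj (X : ExtSpectralSequence.{u, v} R) : LinearWitnessBook.{u, v} R where
  page r :=
    { X := fun p k => ModuleCat.of R (X.nerveModule r p k)
      d := X.nerveD r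
      d_d := fun _ _ _ _ _ _ _ _ _ _ _ => rfl }
  w := X.nerveW
  s := X.nerveS
  w_s _ _ _ _ _ _ := rfl
  s_w r p k p' hp z := nerve_ext (X := X) (r := r + 1) (p := p') (k := k) (fun _ => rfl)
    (fun i q => X.extendByZero_zero r q.1.1 q.1.2 i)
  w_d_s r p k p₁ p' k' h₁ hp hp' hk z := nerve_ext (X := X) (r := r) (p := p') (k := k')
    (fun i => X.extendByZero_of_lt r p' k' (fun j => z.1.2 j ⟨(p', k'), hp, hk⟩)
      ⟨i, by omega⟩ i.2) (fun _ _ => rfl)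

/-- The map induced by a morphism on `𝒩(X)_r`, applied entrywise. -/
def nerveMap {X Y : ExtSpectralSequence.{u, v} R} (f : X ⟶ Y) (r : ℕ) (p k : ℤ) :
    X.nerveModule r p k →ₗ[R] Y.nerveModule r p k where
  toFun z := ⟨(fun i => (f.f i).f p k (z.1.1 i), fun i q => (f.f i).f q.1.1 q.1.2 (z.1.2 i q)),
    fun i h => (z.2.1 i h).map f, fun q => ⟨fun i h => ((z.2.2 q).1 i h).map f, by
      change (Y.page r).d p k q.1.1 q.1.2 q.2.1 q.2.2 ((f.f r).f p k (z.1.1 ⟨r, by omega⟩)) =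
        (f.f r).f q.1.1 q.1.2 (z.1.2 ⟨r, by omega⟩ q)
      rw [← (z.2.2 q).2, (f.f r).comm]⟩⟩
  map_add' z z' := nerve_ext (fun _ => map_add _ _ _) (fun _ _ => map_add _ _ _)
  map_smul' c z := nerve_ext (fun _ => map_smul _ _ _) (fun _ _ => map_smul _ _ _)

/-- The functor `𝒩` from extended spectral sequences to linear witness books. -/
def nerve (R : Type u) [CommRing R] :
    ExtSpectralSequence.{u, v} R ⥤ LinearWitnessBook.{u, v} R where
  obj X := X.nerveObj
  map {_ Y} f :=
    { f := fun r =>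
        { f := nerveMap f r
          comm := fun _ _ p' k' _ _ _ => nerve_ext (X := Y) (r := r) (p := p') (k := k')
            (fun _ => rfl) (fun i q => map_zero ((f.f i).f q.1.1 q.1.2)) }
      comm_w := fun r p k _ => nerve_ext (X := Y) (r := r) (p := p) (k := k)
        (fun _ => rfl) (fun i q => map_zero ((f.f i).f q.1.1 q.1.2))
      comm_s := fun r _ k p' hp z => nerve_ext (X := Y) (r := r + 1) (p := p') (k := k)
        (fun i => map_zero ((f.f i).f p' k))
        (fun i q => extendByZero_map f r q.1.1 q.1.2
          (fun j => z.1.2 j (Target.ofSucc hp q)) i) }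
  map_id _ := rfl
  map_comp _ _ := rfl

theorem IsSpectralSequence.nerve {X : ExtSpectralSequence.{u, v} R} (h : X.IsSpectralSequence) :
    X.nerveObj.IsSpectral where
  s_eq_zero r p k p' k' p₁ hp hk h₁ (z : X.nerveModule r p k) hz := by
    replace hz : X.nerveD r p k p' k' hp hk z = 0 := hz
    refine nerve_ext (X := X) (r := r + 1) (p := p₁) (k := k) (fun i => rfl) (fun i q => ?_)
    change X.extendByZero r q.1.1 q.1.2 (fun j => z.1.2 j (Target.ofSucc h₁ q)) i = 0
    by_cases hi : (i : ℕ) < r + 1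
    · refine (X.extendByZero_of_lt r q.1.1 q.1.2 (fun j => z.1.2 j (Target.ofSucc h₁ q)) i hi).trans ?_
      obtain ⟨⟨a, b⟩, hq, hq'⟩ := q
      obtain rfl : a = p' := by dsimp only at hq; push_cast at hq; omega
      obtain rfl : b = k' := hq'.symm.trans hk
      exact congrFun (congrArg (fun t : X.nerveModule r _ _ => t.1.1) hz) ⟨i, hi⟩
    · exact dif_neg hi
  exists_w r p k p' k' hp hk (z : X.nerveModule r p k) hz := by
    replace hz : X.nerveD r p k p' k' hp hk z = 0 := hz
    have hy : ∀ i q, z.1.2 i q = 0 := by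
      rintro i ⟨⟨a, b⟩, hq, hq'⟩
      obtain rfl : a = p' := by dsimp only at hq; omega
      obtain rfl : b = k' := hq'.symm.trans hk
      exact congrFun (congrArg (fun t : X.nerveModule r _ _ => t.1.1) hz) i
    have hc : z.1.1 ⟨r, by omega⟩ ∈ (X.page r).cycles p k := by
      rw [(X.page r).mem_cycles p k p' k' hp hk, (z.2.2 ⟨(p', k'), hp, hk⟩).2, hy]
    obtain ⟨c, hcc⟩ := (h r p k).2 ((X.page r).homologyMk p k ⟨_, hc⟩)
    have hex := fun q : Target (r + 1) p k => X.exists_lifts (r + 1) q.1.1 q.1.2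
      ((X.page (r + 1)).d p k q.1.1 q.1.2 q.2.1 q.2.2 c)
    choose y hy1 hy2 using hex
    have hex' : ∃ x : ∀ i : Fin (r + 1 + 1), (X.page i).X p k, x ⟨r + 1, by omega⟩ = c ∧
        ∀ i : Fin (r + 1), x ⟨i, by omega⟩ = z.1.1 i := by
      refine ⟨fun i => if hi : (i : ℕ) < r + 1 then z.1.1 ⟨i, hi⟩ else
        (show r + 1 = i by omega) ▸ c, ?_, fun i => ?_⟩
      · exact dif_neg (by dsimp only; omega)
      · exact dif_pos i.2
    obtain ⟨x, hx1, hx2⟩ := hex'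
    refine ⟨⟨(x, fun i q => y q i), ?_, fun q => ⟨fun i hi => hy2 q i hi, ?_⟩⟩, ?_⟩
    · intro i hi
      change X.Lifts i p k (x ⟨i, _⟩) (x ⟨i + 1, _⟩)
      rw [hx2 ⟨i, hi⟩]
      by_cases hi' : i < r
      · rw [hx2 ⟨i + 1, by omega⟩]
        exact z.2.1 i hi'
      · obtain rfl : i = r := by omega
        rw [hx1]
        exact ⟨hc, hcc⟩
    · change (X.page (r + 1)).d p k q.1.1 q.1.2 q.2.1 q.2.2 (x ⟨r + 1, _⟩) = y q (r + 1)
      rw [hx1, hy1]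
    · exact nerve_ext (X := X) (fun i => hx2 i) (fun i q => (hy i q).symm)
  exists_s r p k p' hp (z : X.nerveModule (r + 1) p k) hz := by
    replace hz : X.nerveW r p k z = 0 := hz
    have hx : ∀ i (hi : i < r + 1), z.1.1 ⟨i, by omega⟩ = 0 := fun i hi =>
      congrFun (congrArg (fun t : X.nerveModule r p k => t.1.1) hz) ⟨i, hi⟩
    have hx' : z.1.1 ⟨r + 1, by omega⟩ = 0 := by
      obtain ⟨h1, h2⟩ := z.2.1 r (by omega)
      apply (h r p k).1
      rw [map_zero, h2, BigradedComplex.homologyMk_eq_zero]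
      change z.1.1 ⟨r, _⟩ ∈ _
      rw [hx r (by omega)]
      exact Submodule.zero_mem _
    have hq : ∀ q : Target r p' k, q.1.1 + ((r + 1 : ℕ) : ℤ) = p := fun q => by
      have := q.2.1
      push_cast
      omega
    have hy' : ∀ q : Target (r + 1) p k, z.1.2 ⟨r + 1, by omega⟩ q = 0 := fun q => by
      rw [← (z.2.2 q).2, hx', map_zero]
    have hc : ∃ c : (X.page r).X p' k, ∀ q : Target r p' k,
        (X.page r).d p' k q.1.1 q.1.2 q.2.1 q.2.2 c =
          z.1.2 ⟨r, by omega⟩ ⟨q.1, hq q, q.2.2⟩ := by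
      have q₀ : Target r p' k := ⟨(p' - r, k + 1), by dsimp only; omega, rfl⟩
      obtain ⟨h1, h2⟩ := (z.2.2 ⟨q₀.1, hq q₀, q₀.2.2⟩).1 r (by omega)
      change X.φ r _ _ (z.1.2 ⟨r + 1, by omega⟩ ⟨q₀.1, hq q₀, q₀.2.2⟩) = _ at h2
      rw [hy', map_zero, eq_comm, BigradedComplex.homologyMk_eq_zero,
        BigradedComplex.mem_boundaries _ p' k q₀.1.1 q₀.1.2 q₀.2.1 q₀.2.2] at h2
      obtain ⟨c, hc⟩ := h2
      refine ⟨c, fun q => ?_⟩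
      obtain rfl : q = q₀ := Subtype.ext (Prod.ext
        (by have := q.2.1; have := q₀.2.1; omega) (q.2.2.symm.trans q₀.2.2))
      exact hc
    obtain ⟨c, hc⟩ := hc
    obtain ⟨x, hx1, hx2⟩ := X.exists_lifts r p' k c
    refine ⟨⟨(fun i => x i, fun i q => z.1.2 ⟨i, by omega⟩ ⟨q.1, hq q, q.2.2⟩),
      fun i hi => hx2 i hi, fun q => ⟨fun i hi => (z.2.2 ⟨q.1, hq q, q.2.2⟩).1 i (by omega), ?_⟩⟩, ?_⟩
    · change (X.page r).d _ _ _ _ _ _ (x r) = _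
      rw [hx1, hc]
    · refine nerve_ext (X := X) (r := r + 1) (p := p) (k := k) (fun i => ?_) (fun i q => ?_)
      · by_cases hi : (i : ℕ) < r + 1
        · exact (hx i hi).symm
        · obtain ⟨i, hi'⟩ := i
          obtain rfl : i = r + 1 := by dsimp only at hi; omega
          exact hx'.symm
      · by_cases hi : (i : ℕ) < r + 1
        · exact X.extendByZero_of_lt r q.1.1 q.1.2
            (fun j => z.1.2 ⟨j, by omega⟩ ⟨q.1, q.2.1, q.2.2⟩) i hi
        · obtain ⟨i, hi'⟩ := i
          obtain rfl : i = r + 1 := by dsimp only at hi; omega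
          exact (X.extendByZero_last r q.1.1 q.1.2
            (fun j => z.1.2 ⟨j, by omega⟩ ⟨q.1, q.2.1, q.2.2⟩)).trans (hy' q).symm

/-- The décalage functor on extended spectral sequences. The functor `𝒬_{≥ 1}` is the transfer
`𝒯 ∘ 𝒬 ∘ 𝒯⁻¹` of `𝒬`, so that `𝒯⁻¹ ∘ 𝒬_{≥ 1} ∘ 𝒰_{≥ 1} ∘ 𝒩` is
`𝒬 ∘ (𝒯⁻¹ ∘ 𝒰_{≥ 1}) ∘ 𝒩`. -/
def dec (R : Type u) [CommRing R] :
    ExtSpectralSequence.{u, v} R ⥤ ExtSpectralSequence.{u, v} R :=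
  nerve R ⋙ LinearWitnessBook.turn R ⋙ LinearWitnessBook.quot R

end ExtSpectralSequence

/-- The décalage functor on spectral sequences. -/
def SpecSeq.dec (R : Type u) [CommRing R] : SpecSeq.{u, v} R ⥤ SpecSeq.{u, v} R :=
  ObjectProperty.lift _ (ObjectProperty.ι _ ⋙ ExtSpectralSequence.dec R)
    (fun X => (ExtSpectralSequence.IsSpectralSequence.nerve X.property).turn.quot)

/-!
### Filtered complexes, their spectral sequences and Deligne's décalage
-/

/-- Filtered complexes of `R`-modules: cochain complexes with an increasing filtration
`F p` by subcomplexes. -/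
structure FilteredComplex (R : Type u) [CommRing R] where
  K : CochainComplex (ModuleCat.{v} R) ℤ
  F : ∀ p k : ℤ, Submodule R (K.X k)
  mono : ∀ p p' k : ℤ, p ≤ p' → F p k ≤ F p' k
  d_mem : ∀ (p k k' : ℤ) (x : K.X k), x ∈ F p k → (K.d k k').hom x ∈ F p k'

namespace FilteredComplex

variable {R : Type u} [CommRing R]

/-- Morphisms of filtered complexes: the filtration preserving chain maps. -/
@[ext]
structure Hom (C D : FilteredComplex.{u, v} R) where
  f : C.K ⟶ D.K
  map_mem : ∀ (p k : ℤ) (x : C.K.X k), x ∈ C.F p k → (f.f k).hom x ∈ D.F p k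

instance : Category (FilteredComplex.{u, v} R) where
  Hom C D := Hom C D
  id C := { f := 𝟙 C.K, map_mem := fun _ _ _ hx => hx }
  comp f g :=
    { f := f.f ≫ g.f
      map_mem := fun p k x hx => g.map_mem p k _ (f.map_mem p k x hx) }

/-- The differential of a filtered complex. -/
def d (C : FilteredComplex.{u, v} R) (k k' : ℤ) : C.K.X k →ₗ[R] C.K.X k' :=
  (C.K.d k k').hom

/-- The components of a morphism of filtered complexes. -/
def homAt {C D : FilteredComplex.{u, v} R} (f : C ⟶ D) (k : ℤ) : C.K.X k →ₗ[R] D.K.X k :=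
  (f.f.f k).hom

theorem d_d (C : FilteredComplex.{u, v} R) (k k' k'' : ℤ) (x : C.K.X k) :
    C.d k' k'' (C.d k k' x) = 0 :=
  congrArg (fun g => g.hom x) (C.K.d_comp_d k k' k'')

theorem homAt_d {C D : FilteredComplex.{u, v} R} (f : C ⟶ D) (k k' : ℤ) (x : C.K.X k) :
    homAt f k' (C.d k k' x) = D.d k k' (homAt f k x) :=
  congrArg (fun g => g.hom x) (f.f.comm k k').symm

/-- `Z_r^{p,p+k} = F_p C^k ∩ d⁻¹ (F_{p-r} C^{k+1})`. -/
def Z (C : FilteredComplex.{u, v} R) (r : ℕ) (p k : ℤ) : Submodule R (C.K.X k) :=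
  C.F p k ⊓ (C.F (p - r) (k + 1)).comap (C.d k (k + 1))

/-- `B_0^{p,p+k} = F_{p-1} C^k` and
`B_{r+1}^{p,p+k} = Z_r^{p-1,p-1+k} + d (Z_r^{p+r,p+r+k-1})`. -/
def B (C : FilteredComplex.{u, v} R) : ∀ (_ : ℕ) (_ k : ℤ), Submodule R (C.K.X k)
  | 0, p, k => C.F (p - 1) k
  | r + 1, p, k => C.Z r (p - 1) k ⊔ (C.Z r (p + r) (k - 1)).map (C.d (k - 1) k)

theorem mem_Z (C : FilteredComplex.{u, v} R) (r : ℕ) (p k p' k' : ℤ) (hp : p' + r = p)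
    (hk : k + 1 = k') (x : C.K.X k) : x ∈ C.Z r p k ↔ x ∈ C.F p k ∧ C.d k k' x ∈ C.F p' k' := by
  obtain rfl : p' = p - r := by omega
  subst hk
  exact Iff.rfl

theorem mem_B_succ (C : FilteredComplex.{u, v} R) (r : ℕ) (p k p₁ p₂ k' : ℤ)
    (h₁ : p₁ + 1 = p) (h₂ : p + r = p₂) (hk : k' + 1 = k) (x : C.K.X k) :
    x ∈ C.B (r + 1) p k ↔ ∃ a ∈ C.Z r p₁ k, ∃ b ∈ C.Z r p₂ k', a + C.d k' k b = x := by
  obtain rfl : p₁ = p - 1 := by omega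
  obtain rfl : k' = k - 1 := by omega
  subst h₂
  simp [B, Submodule.mem_sup]

theorem Z_succ_le (C : FilteredComplex.{u, v} R) (r : ℕ) (p k : ℤ) :
    C.Z (r + 1) p k ≤ C.Z r p k := fun _ hx =>
  ⟨hx.1, C.mono _ _ _ (by push_cast; omega) hx.2⟩

theorem d_mem_Z (C : FilteredComplex.{u, v} R) (r s : ℕ) (p k p' k' : ℤ) (hp : p' + r = p)
    (hk : k + 1 = k') (x : C.K.X k) (hx : x ∈ C.Z r p k) : C.d k k' x ∈ C.Z s p' k' := by
  rw [C.mem_Z r p k p' k' hp hk] at hx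
  refine ⟨hx.2, ?_⟩
  change C.d k' (k' + 1) (C.d k k' x) ∈ C.F (p' - s) (k' + 1)
  rw [C.d_d]
  exact Submodule.zero_mem _

theorem d_mem_B (C : FilteredComplex.{u, v} R) (r : ℕ) (p k p' k' : ℤ) (hp : p' + r = p)
    (hk : k + 1 = k') (x : C.K.X k) (hx : x ∈ C.B r p k) : C.d k k' x ∈ C.B r p' k' := by
  cases r with
  | zero =>
    obtain rfl : p' = p := by simpa using hp
    exact C.d_mem _ _ _ _ hx
  | succ r =>
    obtain ⟨a, ha, b, hb, rfl⟩ :=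
      (C.mem_B_succ r p k (p - 1) (p + r) (k - 1) (by omega) rfl (by omega) x).1 hx
    rw [C.mem_B_succ r p' k' (p' - 1) (p - 1) k (by omega) (by push_cast at hp; omega) hk]
    exact ⟨0, Submodule.zero_mem _, a, ha, by rw [map_add, C.d_d, zero_add, add_zero]⟩

theorem map_mem_Z {C D : FilteredComplex.{u, v} R} (f : C ⟶ D) (r : ℕ) (p k : ℤ)
    (x : C.K.X k) (hx : x ∈ C.Z r p k) : homAt f k x ∈ D.Z r p k := by
  refine ⟨f.map_mem _ _ _ hx.1, ?_⟩
  change D.d k (k + 1) (homAt f k x) ∈ D.F (p - r) (k + 1)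
  rw [← homAt_d]
  exact f.map_mem _ _ _ hx.2

theorem map_mem_B {C D : FilteredComplex.{u, v} R} (f : C ⟶ D) (r : ℕ) (p k : ℤ)
    (x : C.K.X k) (hx : x ∈ C.B r p k) : homAt f k x ∈ D.B r p k := by
  cases r with
  | zero => exact f.map_mem _ _ _ hx
  | succ r =>
    obtain ⟨a, ha, b, hb, rfl⟩ :=
      (C.mem_B_succ r p k (p - 1) (p + r) (k - 1) (by omega) rfl (by omega) x).1 hx
    rw [D.mem_B_succ r p k (p - 1) (p + r) (k - 1) (by omega) rfl (by omega)]
    exact ⟨_, map_mem_Z f _ _ _ a ha, _, map_mem_Z f _ _ _ b hb, by rw [map_add, homAt_d]⟩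

/-- The page `E_r(C)`, with components `E_r^{p,p+k}(C) = Z_r^{p,p+k} / B_r^{p,p+k}` and the
differential induced by that of `C`. -/
def page (C : FilteredComplex.{u, v} R) (r : ℕ) : BigradedComplex.{u, v} R r where
  X p k := ModuleCat.of R (C.Z r p k ⧸ (C.B r p k).submoduleOf (C.Z r p k))
  d p k p' k' hp hk := Submodule.mapQ _ _ ((C.d k k').restrict (C.d_mem_Z r r p k p' k' hp hk))
    (fun x hx => C.d_mem_B r p k p' k' hp hk x hx)
  d_d p k p' k' p'' k'' hp hk hp' hk' x := by
    obtain ⟨⟨x, hx⟩, rfl⟩ := Submodule.Quotient.mk_surjective _ x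
    refine (Submodule.Quotient.mk_eq_zero _).2 ?_
    change C.d k' k'' (C.d k k' x) ∈ C.B r p'' k''
    rw [C.d_d]
    exact Submodule.zero_mem _

/-- The class `[x]_r` in `E_r^{p,p+k}(C)` of an element `x` of `Z_r^{p,p+k}`. -/
def pageMk (C : FilteredComplex.{u, v} R) (r : ℕ) (p k : ℤ) :
    C.Z r p k →ₗ[R] (C.page r).X p k :=
  Submodule.mkQ _

theorem pageMk_surjective (C : FilteredComplex.{u, v} R) (r : ℕ) (p k : ℤ) :
    Function.Surjective (C.pageMk r p k) :=
  Submodule.Quotient.mk_surjective _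

theorem pageMk_eq_zero (C : FilteredComplex.{u, v} R) (r : ℕ) (p k : ℤ) (x : C.Z r p k) :
    C.pageMk r p k x = 0 ↔ (x : C.K.X k) ∈ C.B r p k :=
  Submodule.Quotient.mk_eq_zero _

theorem page_d_mk (C : FilteredComplex.{u, v} R) (r : ℕ) (p k p' k' : ℤ) (hp : p' + r = p)
    (hk : k + 1 = k') (x : C.Z r p k) :
    (C.page r).d p k p' k' hp hk (C.pageMk r p k x) =
      C.pageMk r p' k' ⟨C.d k k' x, C.d_mem_Z r r p k p' k' hp hk x x.2⟩ :=
  rfl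

theorem pageMk_mem_cycles_iff (C : FilteredComplex.{u, v} R) (r : ℕ) (p k p' k' : ℤ)
    (hp : p' + r = p) (hk : k + 1 = k') (x : C.Z r p k) :
    C.pageMk r p k x ∈ (C.page r).cycles p k ↔ C.d k k' x ∈ C.B r p' k' := by
  rw [(C.page r).mem_cycles p k p' k' hp hk, page_d_mk, pageMk_eq_zero]

theorem pageMk_mem_boundaries_iff (C : FilteredComplex.{u, v} R) (r : ℕ) (p k p' k' : ℤ)
    (hp : p + r = p') (hk : k' + 1 = k) (x : C.Z r p k) :
    C.pageMk r p k x ∈ (C.page r).boundaries p k ↔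
      ∃ y ∈ C.Z r p' k', C.d k' k y - x ∈ C.B r p k := by
  rw [(C.page r).mem_boundaries p' k' p k hp hk]
  constructor
  · rintro ⟨y, hy⟩
    obtain ⟨⟨y, hy'⟩, rfl⟩ := C.pageMk_surjective r p' k' y
    rw [page_d_mk, ← sub_eq_zero, ← map_sub, pageMk_eq_zero] at hy
    exact ⟨y, hy', hy⟩
  · rintro ⟨y, hy', hy⟩
    refine ⟨C.pageMk r p' k' ⟨y, hy'⟩, ?_⟩
    rw [page_d_mk, ← sub_eq_zero, ← map_sub, pageMk_eq_zero]
    exact hy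

theorem mk_mem_cycles (C : FilteredComplex.{u, v} R) (r : ℕ) (p k : ℤ) (x : C.Z (r + 1) p k) :
    C.pageMk r p k (Submodule.inclusion (C.Z_succ_le r p k) x) ∈ (C.page r).cycles p k := by
  rw [C.pageMk_mem_cycles_iff r p k (p - r) (k + 1) (by omega) rfl]
  have h := C.d_mem_Z (r + 1) (r - 1) p k (p - r - 1) (k + 1) (by push_cast; omega) rfl _ x.2
  cases r with
  | zero => exact h.1
  | succ r =>
    rw [C.mem_B_succ r _ _ (p - (r + 1 : ℕ) - 1) _ k (by omega) rfl rfl]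
    exact ⟨_, h, 0, Submodule.zero_mem _, by rw [map_zero, add_zero]; rfl⟩

/-- The spectral sequence of a filtered complex, as an extended spectral sequence: the
characteristic maps send `[x]_{r+1}` to the homology class of `[x]_r`. -/
def extSpectralSequence (C : FilteredComplex.{u, v} R) : ExtSpectralSequence.{u, v} R where
  page := C.page
  φ r p k := Submodule.liftQ ((C.B (r + 1) p k).submoduleOf (C.Z (r + 1) p k))
    (((C.page r).homologyMk p k).comp
      (((C.pageMk r p k).comp (Submodule.inclusion (C.Z_succ_le r p k))).codRestrict _
        (C.mk_mem_cycles r p k)))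
    (by
      rintro ⟨x, hx⟩ hxB
      obtain ⟨a, ha, b, hb, rfl⟩ :=
        (C.mem_B_succ r p k (p - 1) (p + r) (k - 1) (by omega) rfl (by omega) x).1 hxB
      refine ((C.page r).homologyMk_eq_zero p k _).2 ?_
      refine (C.pageMk_mem_boundaries_iff r p k (p + r) (k - 1) rfl (by omega) _).2 ⟨b, hb, ?_⟩
      change C.d (k - 1) k b - (a + C.d (k - 1) k b) ∈ _
      rw [show C.d (k - 1) k b - (a + C.d (k - 1) k b) = -a by abel]
      refine Submodule.neg_mem _ ?_
      cases r with
      | zero => exact ha.1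
      | succ r =>
        rw [C.mem_B_succ r p k (p - 1) (p + r) (k - 1) (by omega) rfl (by omega)]
        exact ⟨a, C.Z_succ_le _ _ _ ha, 0, Submodule.zero_mem _, by rw [map_zero, add_zero]⟩)

theorem extSpectralSequence_φ_mk (C : FilteredComplex.{u, v} R) (r : ℕ) (p k : ℤ)
    (x : C.Z (r + 1) p k) :
    C.extSpectralSequence.φ r p k (C.pageMk (r + 1) p k x) = (C.page r).homologyMk p k
      ⟨C.pageMk r p k (Submodule.inclusion (C.Z_succ_le r p k) x), C.mk_mem_cycles r p k x⟩ :=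
  rfl

theorem isSpectralSequence (C : FilteredComplex.{u, v} R) :
    C.extSpectralSequence.IsSpectralSequence := by
  intro r p k
  constructor
  · refine (injective_iff_map_eq_zero _).2 fun x hx => ?_
    obtain ⟨⟨x, hxZ⟩, rfl⟩ := C.pageMk_surjective (r + 1) p k x
    rw [extSpectralSequence_φ_mk] at hx
    obtain ⟨y, hy, hB⟩ := (C.pageMk_mem_boundaries_iff r p k (p + r) (k - 1) rfl (by omega) _).1
      (((C.page r).homologyMk_eq_zero p k _).1 hx)
    change C.d (k - 1) k y - x ∈ _ at hB
    refine (C.pageMk_eq_zero (r + 1) p k _).2 ?_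
    refine (C.mem_B_succ r p k (p - 1) (p + r) (k - 1) (by omega) rfl (by omega) x).2 ?_
    have hdx : C.d k (k + 1) x ∈ C.F (p - 1 - r) (k + 1) :=
      ((C.mem_Z (r + 1) p k (p - 1 - r) (k + 1) (by push_cast; omega) rfl x).1 hxZ).2
    -- it suffices to correct `y` so that `x - d y` lies in `F (p - 1)`
    suffices h : ∃ y' ∈ C.Z r (p + r) (k - 1), x - C.d (k - 1) k y' ∈ C.F (p - 1) k by
      obtain ⟨y', hy', hF⟩ := h
      refine ⟨x - C.d (k - 1) k y', ⟨hF, ?_⟩, y', hy', by abel⟩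
      change C.d k (k + 1) (x - C.d (k - 1) k y') ∈ C.F (p - 1 - r) (k + 1)
      rw [map_sub, C.d_d, sub_zero]
      exact hdx
    cases r with
    | zero =>
      refine ⟨y, hy, ?_⟩
      rw [show x - C.d (k - 1) k y = -(C.d (k - 1) k y - x) by abel]
      exact Submodule.neg_mem _ hB
    | succ r =>
      obtain ⟨a, ha, b, hb, hab⟩ :=
        (C.mem_B_succ r p k (p - 1) (p + r) (k - 1) (by omega) rfl (by omega) _).1 hB
      refine ⟨y - b, Submodule.sub_mem _ hy ?_, ?_⟩
      · rw [C.mem_Z r (p + r) (k - 1) p k (by omega) (by omega)] at hb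
        rw [C.mem_Z (r + 1) _ (k - 1) p k rfl (by omega)]
        exact ⟨C.mono _ _ _ (by push_cast; omega) hb.1, hb.2⟩
      · have : x - C.d (k - 1) k (y - b) = -a := by
          rw [map_sub, eq_sub_of_add_eq hab]
          abel
        rw [this]
        exact Submodule.neg_mem _ ha.1
  · intro z
    obtain ⟨⟨z, hz⟩, rfl⟩ := (C.page r).homologyMk_surjective p k z
    obtain ⟨⟨z, hzZ⟩, rfl⟩ := C.pageMk_surjective r p k z
    have hB := (C.pageMk_mem_cycles_iff r p k (p - r) (k + 1) (by omega) rfl _).1 hz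
    change C.d k (k + 1) z ∈ _ at hB
    have h : ∃ x ∈ C.Z (r + 1) p k, x - z ∈ C.B r p k := by
      cases r with
      | zero =>
        refine ⟨z, ⟨hzZ.1, C.mono _ _ _ (by push_cast; omega) hB⟩, ?_⟩
        rw [sub_self]
        exact Submodule.zero_mem _
      | succ r =>
        obtain ⟨a, ha, b, hb, hab⟩ := (C.mem_B_succ r (p - (r + 1 : ℕ)) (k + 1)
          (p - (r + 1 : ℕ) - 1) (p - 1) k (by omega) (by push_cast; omega) rfl _).1 hB
        refine ⟨z - b, (C.mem_Z (r + 1 + 1) p k (p - (r + 1 + 1 : ℕ)) (k + 1) (by omega) rfl _).2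
          ⟨Submodule.sub_mem _ hzZ.1 (C.mono _ _ _ (by omega) hb.1), ?_⟩, ?_⟩
        · rw [map_sub, ← hab, add_sub_cancel_right]
          exact C.mono _ _ _ (by push_cast; omega) ha.1
        · rw [show z - b - z = -b by abel,
            C.mem_B_succ r p k (p - 1) (p + r) (k - 1) (by omega) rfl (by omega)]
          exact ⟨-b, Submodule.neg_mem _ hb, 0, Submodule.zero_mem _,
            by rw [map_zero, add_zero]⟩
    obtain ⟨x, hx, hxz⟩ := h
    refine ⟨C.pageMk (r + 1) p k ⟨x, hx⟩, ?_⟩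
    rw [extSpectralSequence_φ_mk]
    have he : C.pageMk r p k ⟨x, C.Z_succ_le r p k hx⟩ = C.pageMk r p k ⟨z, hzZ⟩ := by
      rw [← sub_eq_zero, ← map_sub, pageMk_eq_zero]
      exact hxz
    exact congrArg ((C.page r).homologyMk p k) (Subtype.ext he)

/-- The functor `E` that sends a filtered complex to its spectral sequence. -/
def E (R : Type u) [CommRing R] : FilteredComplex.{u, v} R ⥤ SpecSeq.{u, v} R :=
  ObjectProperty.lift _
    { obj := fun C => C.extSpectralSequence
      map := fun {C D} f =>
        { f := fun r =>
            { f := fun p k => Submodule.mapQ ((C.B r p k).submoduleOf (C.Z r p k))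
                ((D.B r p k).submoduleOf (D.Z r p k)) ((homAt f k).restrict (map_mem_Z f r p k))
                (fun x hx => map_mem_B f r p k x hx)
              comm := fun p k p' k' hp hk x => by
                obtain ⟨x, rfl⟩ := C.pageMk_surjective r p k x
                change D.pageMk r p' k' ⟨homAt f k' (C.d k k' x), _⟩ =
                  D.pageMk r p' k' ⟨D.d k k' (homAt f k x), _⟩
                congr 2
                exact homAt_d f k k' x }
          comm := fun r p k x => by
            obtain ⟨x, rfl⟩ := C.pageMk_surjective (r + 1) p k x
            rfl }
      map_id := fun C => by
        refine ExtSpectralSequence.Hom.ext (funext fun r => BigradedComplex.Hom.ext ?_)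
        refine funext fun p => funext fun k => LinearMap.ext fun x => ?_
        obtain ⟨x, rfl⟩ := C.pageMk_surjective r p k x
        rfl
      map_comp := fun {C _ _} f g => by
        refine ExtSpectralSequence.Hom.ext (funext fun r => BigradedComplex.Hom.ext ?_)
        refine funext fun p => funext fun k => LinearMap.ext fun x => ?_
        obtain ⟨x, rfl⟩ := C.pageMk_surjective r p k x
        rfl }
    (fun C => C.isSpectralSequence)

/-- Deligne's décalage `Dec C` of a filtered complex: the same complex with the filtration
`(Dec F)_p C^k = Z_1^{p-k,p} = F_{p-k} C^k ∩ d⁻¹ (F_{p-k-1} C^{k+1})`. -/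
def decObj (C : FilteredComplex.{u, v} R) : FilteredComplex.{u, v} R where
  K := C.K
  F p k := C.Z 1 (p - k) k
  mono _ _ _ h _ hx := ⟨C.mono _ _ _ (by omega) hx.1, C.mono _ _ _ (by omega) hx.2⟩
  d_mem p k k' x hx := by
    by_cases hk : k + 1 = k'
    · exact C.d_mem_Z 1 1 (p - k) k (p - k') k' (by push_cast; omega) hk x hx
    · rw [C.K.shape k k' hk]
      exact Submodule.zero_mem _

/-- Deligne's décalage functor on filtered complexes. -/
def dec (R : Type u) [CommRing R] : FilteredComplex.{u, v} R ⥤ FilteredComplex.{u, v} R where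
  obj C := C.decObj
  map f := { f := f.f, map_mem := fun _ _ x hx => map_mem_Z f 1 _ _ x hx }

theorem Z_dec_le (C : FilteredComplex.{u, v} R) (r : ℕ) (p k : ℤ) (i : ℕ) (hi : i ≤ r + 1) :
    C.decObj.Z r p k ≤ C.Z i (p - k) k := fun _ hx =>
  ⟨hx.1.1, C.mono _ _ _ (by omega) hx.2.1⟩

theorem d_mem_Z_of_mem_Z_dec (C : FilteredComplex.{u, v} R) (r : ℕ) (p k : ℤ) (i : ℕ)
    (q : ExtSpectralSequence.Target (r + 1) (p - k) k) (x : C.K.X k)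
    (hx : x ∈ C.decObj.Z r p k) : C.d k q.1.2 x ∈ C.Z i q.1.1 q.1.2 :=
  C.d_mem_Z (r + 1) i _ _ _ _ q.2.1 q.2.2 x (C.Z_dec_le r p k (r + 1) le_rfl hx)

/-- For `x` in `Z_r^{p,p+k}(Dec C)`, the element
`([x]_0, …, [x]_{r+1}; [dx]_0, …, [dx]_{r+1})` of `𝒩(E(C))_{r+1}`. -/
def decNerve (C : FilteredComplex.{u, v} R) (r : ℕ) (p k : ℤ) (x : C.decObj.Z r p k) :
    C.extSpectralSequence.nerveModule (r + 1) (p - k) k :=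
  ⟨(fun i => C.pageMk i (p - k) k ⟨x.1, C.Z_dec_le r p k i (by omega) x.2⟩,
    fun i q => C.pageMk i q.1.1 q.1.2 ⟨C.d k q.1.2 x.1, C.d_mem_Z_of_mem_Z_dec r p k i q x.1 x.2⟩),
    fun i _ => ⟨C.mk_mem_cycles i _ _ ⟨x.1, C.Z_dec_le r p k (i + 1) (by omega) x.2⟩, rfl⟩,
    fun q => ⟨fun i _ => ⟨C.mk_mem_cycles i _ _
      ⟨_, C.d_mem_Z_of_mem_Z_dec r p k (i + 1) q x.1 x.2⟩, rfl⟩, rfl⟩⟩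

end FilteredComplex

/-! Write (p, k) for filtration degree and total degree. An element x of Z_r(Dec C) in degree (p, k)
satisfies x ∈ F_{p-k} and dx ∈ F_{p-k-r-1}, so x lies in Z_{r+1}(C) in degree (p - k, k). Hence x
has classes [x]_0, …, [x]_{r+1} and dx has classes [dx]_0, …, [dx]_{r+1}, and these form an element
of the nerve of E(C).

This assignment turns the structure of the filtered complex into that of a linear witness book. The
differential goes to d (`decNerveHom_d`), and the inclusion Z_{r+1} ⊆ Z_r goes to w
(`w_decNerveHom`). The inclusion of Z_r in degree p into Z_{r+1} in degree p + 1 goes to s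
(`decNerveHom_pred`). Since B_{r+1}(Dec C) consists of elements coming from one filtration step
below plus boundaries of such elements, it lands in Im s + d Im s (`decNerveHom_mem_degen`). The
assignment therefore descends to a morphism E(Dec C) → Dec(E(C)) of extended spectral sequences.

Both sides are spectral sequences, so each page is the homology of the preceding one, and
bijectivity propagates from the page 0 (`bijective_of_page_zero`). The later pages need no separate
computation.

On the page 0 nothing is divided out of the nerve. Injectivity (`decPageHom_zero_bijective`) holds
because [x]_0 = 0 and [dx]_0 = 0 say exactly that x lies one step lower in the filtration Dec F.
Surjectivity (`decNerveHom_zero_surjective`) is the main computation: for (x_0, x_1; y_0, y_1), a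
representative x of x_1 is corrected to x + db + c, where b adjusts the class in E_0 to x_0 and c
adjusts the class of the differential to y_0, without changing the classes in E_1. -/

namespace BigradedComplex

variable {R : Type u} [CommRing R] {r : ℕ}

/-! ### Homology and inverses of degreewise bijective morphisms -/

theorem homologyMap_mk {A B : BigradedComplex.{u, v} R r} (f : A ⟶ B) (p k : ℤ)
    (x : A.cycles p k) : homologyMap f p k (A.homologyMk p k x) =
      B.homologyMk p k ⟨f.f p k x, map_mem_cycles f p k x x.2⟩ :=
  rfl

theorem homologyMap_bijective {A B : BigradedComplex.{u, v} R r} (f : A ⟶ B)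
    (hf : ∀ p k, Function.Bijective (f.f p k)) (p k : ℤ) :
    Function.Bijective (homologyMap f p k) := by
  constructor
  · refine (injective_iff_map_eq_zero _).2 fun x hx => ?_
    obtain ⟨x, rfl⟩ := A.homologyMk_surjective p k x
    rw [homologyMap_mk, homologyMk_eq_zero,
      mem_boundaries _ (p + r) (k - 1) p k rfl (by omega)] at hx
    obtain ⟨y, hy⟩ := hx
    obtain ⟨y, rfl⟩ := (hf _ _).2 y
    rw [← f.comm] at hy
    exact (A.homologyMk_eq_zero p k x).2
      ((A.mem_boundaries _ _ p k _ _ _).2 ⟨y, (hf _ _).1 hy⟩)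
  · intro y
    obtain ⟨⟨y, hy⟩, rfl⟩ := B.homologyMk_surjective p k y
    obtain ⟨x, rfl⟩ := (hf p k).2 y
    have hx : x ∈ A.cycles p k := by
      rw [mem_cycles _ p k (p - r) (k + 1) (by omega) rfl, ← f.comm] at hy
      exact (A.mem_cycles p k _ _ (by omega) rfl x).2 ((hf _ _).1 (hy.trans (map_zero _).symm))
    exact ⟨A.homologyMk p k ⟨x, hx⟩, rfl⟩

/-- The inverse of a degreewise bijective morphism. -/
noncomputable def invOfBijective {A B : BigradedComplex.{u, v} R r} (f : A ⟶ B)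
    (hf : ∀ p k, Function.Bijective (f.f p k)) : B ⟶ A where
  f p k := (LinearEquiv.ofBijective (f.f p k) (hf p k)).symm.toLinearMap
  comm p k p' k' hp hk y := by
    refine (hf p' k').1 ?_
    refine (LinearEquiv.apply_symm_apply (LinearEquiv.ofBijective _ (hf p' k')) _).trans ?_
    rw [f.comm]
    exact congrArg (B.d p k p' k' hp hk)
      (LinearEquiv.apply_symm_apply (LinearEquiv.ofBijective _ (hf p k)) y).symm

theorem f_invOfBijective {A B : BigradedComplex.{u, v} R r} (f : A ⟶ B)
    (hf : ∀ p k, Function.Bijective (f.f p k)) (p k : ℤ) (y : B.X p k) :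
    f.f p k ((invOfBijective f hf).f p k y) = y :=
  LinearEquiv.apply_symm_apply (LinearEquiv.ofBijective _ (hf p k)) y

theorem invOfBijective_f {A B : BigradedComplex.{u, v} R r} (f : A ⟶ B)
    (hf : ∀ p k, Function.Bijective (f.f p k)) (p k : ℤ) (x : A.X p k) :
    (invOfBijective f hf).f p k (f.f p k x) = x :=
  LinearEquiv.symm_apply_apply (LinearEquiv.ofBijective _ (hf p k)) x

/-- Serves to compare the pagewise inverse of a morphism with the characteristic maps. -/
theorem homologyMap_invOfBijective {A B : BigradedComplex.{u, v} R r} (f : A ⟶ B)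
    (hf : ∀ p k, Function.Bijective (f.f p k)) (p k : ℤ) (y : B.homology p k) :
    homologyMap f p k (homologyMap (invOfBijective f hf) p k y) = y := by
  obtain ⟨y, rfl⟩ := B.homologyMk_surjective p k y
  rw [homologyMap_mk, homologyMap_mk]
  congr 1
  exact Subtype.ext (f_invOfBijective f hf p k y)

end BigradedComplex

/-! ### Bijectivity and isomorphisms of (extended) spectral sequences -/

namespace ExtSpectralSequence

variable {R : Type u} [CommRing R]

/-- A morphism of extended spectral sequences that is bijective on all pages is an isomorphism. -/
theorem isIso_of_bijective {X Y : ExtSpectralSequence.{u, v} R} (f : X ⟶ Y)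
    (hf : ∀ r p k, Function.Bijective ((f.f r).f p k)) : IsIso f := by
  refine ⟨({ f := fun r => BigradedComplex.invOfBijective (f.f r) (hf r), comm := ?_ } : Hom Y X),
    ?_, ?_⟩
  · intro r p k y
    -- Compatibility of the inverse with the characteristic maps is tested after the injective map
    -- that `f.f r` induces on homology; there both sides become `Y.φ r p k y`.
    refine (BigradedComplex.homologyMap_bijective (f.f r) (hf r) p k).1 ?_
    rw [BigradedComplex.homologyMap_invOfBijective, f.comm, BigradedComplex.f_invOfBijective]
  · exact ExtSpectralSequence.Hom.ext (funext fun r => BigradedComplex.Hom.ext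
      (funext fun p => funext fun k => LinearMap.ext fun x =>
        BigradedComplex.invOfBijective_f (f.f r) (hf r) p k x))
  · exact ExtSpectralSequence.Hom.ext (funext fun r => BigradedComplex.Hom.ext
      (funext fun p => funext fun k => LinearMap.ext fun y =>
        BigradedComplex.f_invOfBijective (f.f r) (hf r) p k y))

/-- A morphism of spectral sequences that is bijective on the page `0` is bijective on all
pages. -/
theorem bijective_of_page_zero {X Y : ExtSpectralSequence.{u, v} R} (hX : X.IsSpectralSequence)
    (hY : Y.IsSpectralSequence) (f : X ⟶ Y)
    (hf : ∀ p k, Function.Bijective ((f.f 0).f p k)) (r : ℕ) :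
    ∀ p k, Function.Bijective ((f.f r).f p k) := by
  induction r with
  | zero => exact hf
  | succ r ih =>
    intro p k
    -- In the square H(f_r) ∘ φ_X = φ_Y ∘ f_{r+1} the left side is bijective by induction, and the
    -- bijection φ_Y can be cancelled on the right side.
    have h := (BigradedComplex.homologyMap_bijective (f.f r) ih p k).comp (hX r p k)
    refine (Function.Bijective.of_comp_iff' (hY r p k) _).1 ?_
    convert h using 1
    exact funext fun x => (f.comm r p k x).symm

end ExtSpectralSequence

/-! ### From the décalage of a filtered complex to the nerve of its spectral sequence -/

namespace FilteredComplex

variable {R : Type u} [CommRing R]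

/-- For i > 0 the first summand of B_i in degree p is Z_{i-1} in degree p - 1, which contains Z_r
there because i - 1 ≤ r; for i = 0 only the filtration degree counts. This is why the classes [x]_i
vanish when x already lies one filtration step lower. -/
theorem Z_pred_le_B (C : FilteredComplex.{u, v} R) (r i : ℕ) (hi : i ≤ r + 1) (p k : ℤ) {p' : ℤ}
    (hp : p' + 1 = p) : C.Z r p' k ≤ C.B i p k := by
  intro x hx
  cases i with
  | zero =>
    obtain rfl : p' = p - 1 := by omega
    exact hx.1
  | succ i =>
    rw [C.mem_B_succ i p k p' (p + i) (k - 1) hp rfl (by omega)]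
    exact ⟨x, ⟨hx.1, C.mono _ _ _ (by omega) hx.2⟩, 0, Submodule.zero_mem _,
      by rw [map_zero, add_zero]⟩

/-- This is the second summand of B_{r+1}. It accounts for the final 0 in s(x; y) = (0; y_0, …, y_r,
0). -/
theorem d_mem_B_of_mem_Z (C : FilteredComplex.{u, v} R) (r : ℕ) (p k p' k' : ℤ) (hp : p' + r = p)
    (hk : k + 1 = k') (x : C.K.X k) (hx : x ∈ C.Z r p k) : C.d k k' x ∈ C.B (r + 1) p' k' := by
  rw [C.mem_B_succ r p' k' (p' - 1) p k (by omega) hp hk]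
  exact ⟨0, Submodule.zero_mem _, x, hx, zero_add _⟩

/-- `decNerve` as a linear map. -/
def decNerveHom (C : FilteredComplex.{u, v} R) (r : ℕ) (p k : ℤ) :
    C.decObj.Z r p k →ₗ[R] (C.extSpectralSequence.nerveObj.turnObj.page r).X p k where
  toFun x := C.decNerve r p k x
  map_add' x y := ExtSpectralSequence.nerve_ext (X := C.extSpectralSequence)
    (fun i => map_add (C.pageMk i (p - k) k) ⟨x.1, C.Z_dec_le r p k i (by omega) x.2⟩
      ⟨y.1, C.Z_dec_le r p k i (by omega) y.2⟩)
    (fun i q => (congrArg (C.pageMk i q.1.1 q.1.2)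
      (Subtype.ext (map_add (C.d k q.1.2) x.1 y.1))).trans
      (map_add (C.pageMk i q.1.1 q.1.2) ⟨_, C.d_mem_Z_of_mem_Z_dec r p k i q x.1 x.2⟩
        ⟨_, C.d_mem_Z_of_mem_Z_dec r p k i q y.1 y.2⟩))
  map_smul' c x := ExtSpectralSequence.nerve_ext (X := C.extSpectralSequence)
    (fun i => map_smul (C.pageMk i (p - k) k) c ⟨x.1, C.Z_dec_le r p k i (by omega) x.2⟩)
    (fun i q => (congrArg (C.pageMk i q.1.1 q.1.2)
      (Subtype.ext (map_smul (C.d k q.1.2) c x.1))).trans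
      (map_smul (C.pageMk i q.1.1 q.1.2) c ⟨_, C.d_mem_Z_of_mem_Z_dec r p k i q x.1 x.2⟩))

/-- Both sides have first row [dx]_i. The nerve differential puts 0 in the second row, which agrees
with [d dx]_i because d² = 0. -/
theorem decNerveHom_d (C : FilteredComplex.{u, v} R) (r : ℕ) (p k p' k' : ℤ) (hp : p' + r = p)
    (hk : k + 1 = k') (x : C.decObj.Z r p k) :
    C.decNerveHom r p' k' ⟨C.d k k' x.1, C.decObj.d_mem_Z r r p k p' k' hp hk x x.2⟩ =
      (C.extSpectralSequence.nerveObj.turnObj.page r).d p k p' k' hp hk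
        (C.decNerveHom r p k x) := by
  refine ExtSpectralSequence.nerve_ext (X := C.extSpectralSequence) (fun i => rfl) fun i q => ?_
  refine (C.pageMk_eq_zero i q.1.1 q.1.2 _).2 ?_
  exact Set.mem_of_eq_of_mem (C.d_d k k' q.1.2 x.1) (Submodule.zero_mem (C.B i q.1.1 q.1.2))

/-- The map w replaces the second row by 0. For x in Z_{r+1}(Dec C) this loses nothing: dx lies one
filtration step below the degree in which the second row of the page r is formed, so each [dx]_i is
already 0. -/
theorem w_decNerveHom (C : FilteredComplex.{u, v} R) (r : ℕ) (p k : ℤ)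
    (x : C.decObj.Z (r + 1) p k) :
    C.extSpectralSequence.nerveObj.turnObj.w r p k (C.decNerveHom (r + 1) p k x) =
      C.decNerveHom r p k (Submodule.inclusion (C.decObj.Z_succ_le r p k) x) := by
  refine ExtSpectralSequence.nerve_ext (X := C.extSpectralSequence) (fun i => rfl) fun i q => ?_
  refine ((C.pageMk_eq_zero i q.1.1 q.1.2 _).2 ?_).symm
  obtain ⟨⟨a, b⟩, hq, hq'⟩ := q
  dsimp only at hq hq'
  refine C.Z_pred_le_B i i (by omega) a b (sub_add_cancel a 1) ?_
  -- As x ∈ Z_{r+2}(C), its differential has filtration degree p - k - (r + 2) = a - 1; being a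
  -- cycle, it lies in Z_i for every i.
  exact C.d_mem_Z (r + 2) i (p - k) k (a - 1) b (by push_cast at hq ⊢; omega) hq' _
    (C.Z_dec_le (r + 1) p k (r + 2) le_rfl x.2)

/-- Raising p and r together leaves p - r, hence the condition on dx, unchanged. Applied to Dec C,
this inclusion is the counterpart of s. -/
theorem Z_dec_pred_le (C : FilteredComplex.{u, v} R) (r : ℕ) (p k p' : ℤ) (hp : p + 1 = p') :
    C.Z r p k ≤ C.Z (r + 1) p' k := fun _ hx =>
  ⟨C.mono _ _ _ (by omega) hx.1, C.mono _ _ _ (by push_cast; omega) hx.2⟩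

/-- Seen one filtration degree higher, x has vanishing classes, whereas dx is formed in the same
degree as before and keeps its classes [dx]_i for i ≤ r + 1. The one new entry, [dx]_{r+2}, vanishes
because dx is the differential of an element of Z_{r+1}(C). -/
theorem decNerveHom_pred (C : FilteredComplex.{u, v} R) (r : ℕ) (p k p' : ℤ) (hp : p + 1 = p')
    (x : C.decObj.Z r p k) :
    C.decNerveHom (r + 1) p' k
        (Submodule.inclusion (C.decObj.Z_dec_pred_le r p k p' hp) x) =
      C.extSpectralSequence.nerveObj.turnObj.s r p k p' hp (C.decNerveHom r p k x) := by
  have hx := C.Z_dec_le r p k (r + 1) le_rfl x.2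
  refine ExtSpectralSequence.nerve_ext (X := C.extSpectralSequence) (fun i => ?_) fun i q => ?_
  · refine (C.pageMk_eq_zero i (p' - k) k _).2 ?_
    exact C.Z_pred_le_B (r + 1) i (by omega) _ _ (by omega) hx
  · have hq := q.2.1
    push_cast at hq
    by_cases hi : (i : ℕ) < r + 1 + 1
    · exact (ExtSpectralSequence.extendByZero_of_lt C.extSpectralSequence (r + 1)
        q.1.1 q.1.2 (fun j => (C.decNerve r p k x).1.2 j ⟨q.1, by push_cast; omega, q.2.2⟩) i hi).symm
    · obtain ⟨i, hi'⟩ := i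
      obtain rfl : i = r + 1 + 1 := by dsimp only at hi; omega
      refine Eq.trans ?_ (ExtSpectralSequence.extendByZero_last C.extSpectralSequence (r + 1)
        q.1.1 q.1.2 (fun j =>
          (C.decNerve r p k x).1.2 j ⟨q.1, by push_cast; omega, q.2.2⟩)).symm
      refine (C.pageMk_eq_zero (r + 1 + 1) q.1.1 q.1.2 _).2 ?_
      exact C.d_mem_B_of_mem_Z (r + 1) (p - k) k _ _ (by push_cast; omega) q.2.2 _ hx

theorem decNerveHom_mem_degen (C : FilteredComplex.{u, v} R) (r : ℕ) (p k : ℤ)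
    (x : C.decObj.Z r p k) (hx : x.1 ∈ C.decObj.B r p k) :
    C.decNerveHom r p k x ∈ C.extSpectralSequence.nerveObj.turnObj.degen r p k := by
  cases r with
  | zero =>
    -- On the page 0 the degenerate part is 0, so all four entries must vanish. They do, since x and
    -- dx both lie in Z_1 one filtration step lower than required.
    have hx' : x.1 ∈ C.Z 1 (p - 1 - k) k := hx
    refine ExtSpectralSequence.nerve_ext (X := C.extSpectralSequence) (fun i => ?_) fun i q => ?_
    · exact (C.pageMk_eq_zero i (p - k) k _).2
        (C.Z_pred_le_B 1 i (by omega) (p - k) k (by omega) hx')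
    · have hq := q.2.1
      refine (C.pageMk_eq_zero i q.1.1 q.1.2 _).2 ?_
      refine C.Z_pred_le_B 1 i (by omega) _ _ (sub_add_cancel q.1.1 1) ?_
      exact C.d_mem_Z 1 1 (p - 1 - k) k _ _ (by push_cast at hq ⊢; omega) q.2.2 _ hx'
  | succ r =>
    obtain ⟨x, hxZ⟩ := x
    obtain ⟨a, ha, b, hb, rfl⟩ := (C.decObj.mem_B_succ r p k (p - 1) (p + r) (k - 1)
      (by omega) rfl (by omega) x).1 hx
    refine (LinearWitnessBook.mem_degen_succ _ r p k (p - 1) (p + r) (p + (r + 1 : ℕ)) (k - 1)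
      (by omega) (by push_cast; omega) rfl (by omega) _).2
      ⟨C.decNerveHom r (p - 1) k ⟨a, ha⟩, C.decNerveHom r (p + r) (k - 1) ⟨b, hb⟩, ?_⟩
    -- For x = a + db, the summand a contributes s of its image and db contributes d s of the image
    -- of b.
    rw [← decNerveHom_pred, ← decNerveHom_pred, ← decNerveHom_d, ← map_add]
    rfl

/-- The map `[x] ↦ ([x]_0, …, [x]_{r+1}; [dx]_0, …, [dx]_{r+1})` on the pages. -/
def decPageHom (C : FilteredComplex.{u, v} R) (r : ℕ) (p k : ℤ) :
    (C.decObj.page r).X p k →ₗ[R] (C.extSpectralSequence.nerveObj.turnObj.quotPage r).X p k :=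
  Submodule.mapQ ((C.decObj.B r p k).submoduleOf (C.decObj.Z r p k))
    (C.extSpectralSequence.nerveObj.turnObj.degen r p k) (C.decNerveHom r p k)
    (C.decNerveHom_mem_degen r p k)

theorem decPageHom_mk (C : FilteredComplex.{u, v} R) (r : ℕ) (p k : ℤ) (x : C.decObj.Z r p k) :
    C.decPageHom r p k (C.decObj.pageMk r p k x) =
      C.extSpectralSequence.nerveObj.turnObj.quotMk r p k (C.decNerveHom r p k x) :=
  rfl

/-- The comparison `E(Dec C) ⟶ Dec (E(C))`. -/
def decComparison (C : FilteredComplex.{u, v} R) :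
    C.decObj.extSpectralSequence ⟶ C.extSpectralSequence.nerveObj.turnObj.quotObj where
  f r :=
    { f := C.decPageHom r
      comm := fun p k p' k' hp hk x => by
        obtain ⟨x, rfl⟩ := C.decObj.pageMk_surjective r p k x
        exact congrArg (C.extSpectralSequence.nerveObj.turnObj.quotMk r p' k')
          (C.decNerveHom_d r p k p' k' hp hk x) }
  comm r p k x := by
    obtain ⟨x, rfl⟩ := C.decObj.pageMk_surjective (r + 1) p k x
    refine congrArg ((C.extSpectralSequence.nerveObj.turnObj.quotPage r).homologyMk p k)
      (Subtype.ext ?_)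
    exact congrArg (C.extSpectralSequence.nerveObj.turnObj.quotMk r p k)
      (C.w_decNerveHom r p k x).symm

/-! ### Bijectivity on the page 0 -/

/-- If the characteristic map sends `[x]_1` to the class of `a`, then `x` can be corrected by the
boundary of an element of `F p` so that its class in the page `0` is `a`. -/
theorem exists_of_lifts_zero (C : FilteredComplex.{u, v} R) (p k k' : ℤ) (hk : k' + 1 = k)
    (a : (C.page 0).X p k) (x : C.Z 1 p k)
    (h : C.extSpectralSequence.Lifts 0 p k a (C.pageMk 1 p k x)) :
    ∃ b ∈ C.F p k', ∀ hZ : (x : C.K.X k) + C.d k' k b ∈ C.Z 0 p k,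
      C.pageMk 0 p k ⟨x + C.d k' k b, hZ⟩ = a := by
  obtain ⟨hc, h⟩ := h
  obtain ⟨⟨a, ha⟩, rfl⟩ := C.pageMk_surjective 0 p k a
  replace h : (C.page 0).homologyMk p k ⟨_, C.mk_mem_cycles 0 p k x⟩ =
      (C.page 0).homologyMk p k ⟨_, hc⟩ := h
  -- Equality of the homology classes makes a - x a boundary in E_0, that is, a - x ≡ db modulo
  -- F_{p-1} for some b in F_p.
  rw [eq_comm, ← sub_eq_zero] at h
  have h' := ((C.page 0).homologyMk_eq_zero p k (⟨_, hc⟩ - ⟨_, C.mk_mem_cycles 0 p k x⟩)).1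
    ((map_sub _ _ _).trans h)
  obtain ⟨b, hb, hB⟩ := (C.pageMk_mem_boundaries_iff 0 p k p k' (by simp) hk
    (⟨a, ha⟩ - Submodule.inclusion (C.Z_succ_le 0 p k) x)).1 (by rw [map_sub]; exact h')
  refine ⟨b, hb.1, fun hZ => ?_⟩
  rw [← sub_eq_zero, ← map_sub, pageMk_eq_zero]
  convert hB using 1
  change (x : C.K.X k) + C.d k' k b - a = C.d k' k b - (a - x)
  abel

theorem F_le_Z_zero (C : FilteredComplex.{u, v} R) (p k : ℤ) : C.F p k ≤ C.Z 0 p k :=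
  fun x hx => (C.mem_Z 0 p k p (k + 1) (by simp) rfl x).2 ⟨hx, C.d_mem _ _ _ _ hx⟩

/-- The preimage of (x_0, x_1; y_0, y_1) is x + db + c with [x]_1 = x_1. The two corrections do not
interfere: db is a cycle, so it does not affect the second row, while c lies in F_{p-k-1} and so is
invisible in E_0 in filtration degree p - k. Both db and c lie in B_1, so x_1 is kept, and dc lies
in B_1 one filtration degree lower, so y_1 is kept. -/
theorem decNerveHom_zero_surjective (C : FilteredComplex.{u, v} R) (p k : ℤ) :
    Function.Surjective (C.decNerveHom 0 p k) := by
  intro (z : C.extSpectralSequence.nerveModule 1 (p - k) k)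
  obtain ⟨x, hx⟩ := C.pageMk_surjective 1 (p - k) k (z.1.1 ⟨1, by omega⟩)
  let q₀ : ExtSpectralSequence.Target 1 (p - k) k :=
    ⟨(p - k - 1, k + 1), by dsimp only; push_cast; omega, rfl⟩
  obtain ⟨b, hb, hxb⟩ := C.exists_of_lifts_zero (p - k) k (k - 1) (by omega)
    (z.1.1 ⟨0, by omega⟩) x
    (by rw [hx]; exact z.2.1 0 (by omega))
  have hdx : C.d k (k + 1) x.1 ∈ C.Z 1 (p - k - 1) (k + 1) :=
    C.d_mem_Z 1 1 (p - k) k _ _ (by push_cast; omega) rfl _ x.2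
  -- The nerve condition d_1 x_1 = y_1 makes dx a representative of y_1, so the second row can be
  -- corrected in the same way as the first.
  have hy : C.pageMk 1 (p - k - 1) (k + 1) ⟨_, hdx⟩ = z.1.2 ⟨1, by omega⟩ q₀ := by
    have h := (z.2.2 q₀).2
    change (C.page 1).d (p - k) k (p - k - 1) (k + 1) _ _ (z.1.1 ⟨1, by omega⟩) = _ at h
    rw [← hx] at h
    exact h
  obtain ⟨c, hc, hyc⟩ := C.exists_of_lifts_zero (p - k - 1) (k + 1) k rfl
    (z.1.2 ⟨0, by omega⟩ q₀) ⟨_, hdx⟩ (by rw [hy]; exact (z.2.2 q₀).1 0 (by omega))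
  have hd : C.d k (k + 1) (x.1 + C.d (k - 1) k b + c) = C.d k (k + 1) x.1 + C.d k (k + 1) c := by
    rw [map_add, map_add, C.d_d, add_zero]
  have hF : C.d k (k + 1) x.1 + C.d k (k + 1) c ∈ C.F (p - k - 1) (k + 1) :=
    Submodule.add_mem _ hdx.1 (C.d_mem _ _ _ _ hc)
  have hxF : (x : C.K.X k) + C.d (k - 1) k b ∈ C.F (p - k) k :=
    Submodule.add_mem _ x.2.1 (C.d_mem _ _ _ _ hb)
  have hx' : x.1 + C.d (k - 1) k b + c ∈ C.Z 1 (p - k) k := by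
    refine (C.mem_Z 1 (p - k) k (p - k - 1) (k + 1) (by push_cast; omega) rfl _).2
      ⟨Submodule.add_mem _ hxF (C.mono _ _ _ (by omega) hc), ?_⟩
    rw [hd]
    exact hF
  refine ⟨⟨x.1 + C.d (k - 1) k b + c, C.decObj.F_le_Z_zero p k hx'⟩, ?_⟩
  refine ExtSpectralSequence.nerve_ext (X := C.extSpectralSequence) (r := 1) (fun i => ?_)
    fun i q => ?_
  · fin_cases i
    · refine Eq.trans ?_ (hxb (C.F_le_Z_zero _ _ hxF))
      refine sub_eq_zero.1 ((map_sub (C.pageMk 0 (p - k) k) _ _).symm.trans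
        ((C.pageMk_eq_zero 0 (p - k) k _).2 ?_))
      change x.1 + C.d (k - 1) k b + c - (x.1 + C.d (k - 1) k b) ∈ C.F (p - k - 1) k
      rwa [add_sub_cancel_left]
    · refine Eq.trans ?_ hx
      refine sub_eq_zero.1 ((map_sub (C.pageMk 1 (p - k) k) _ _).symm.trans
        ((C.pageMk_eq_zero 1 (p - k) k _).2 ?_))
      change x.1 + C.d (k - 1) k b + c - x.1 ∈ C.B (0 + 1) (p - k) k
      refine (C.mem_B_succ 0 (p - k) k (p - k - 1) (p - k) (k - 1) (by omega) (by simp) (by omega)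
        _).2 ⟨c, C.F_le_Z_zero _ _ hc, b, C.F_le_Z_zero _ _ hb, by abel⟩
  -- The type of target degrees has only one point, so the second row need only be checked at `q₀`.
  · obtain rfl : q = q₀ := Subtype.ext (Prod.ext
      (by have := q.2.1; have := q₀.2.1; omega) (q.2.2.symm.trans q₀.2.2))
    fin_cases i
    · refine Eq.trans ?_ (hyc (C.F_le_Z_zero _ _ hF))
      exact congrArg (C.pageMk 0 (p - k - 1) (k + 1)) (Subtype.ext hd)
    · refine Eq.trans ?_ hy
      refine sub_eq_zero.1 ((map_sub (C.pageMk 1 (p - k - 1) (k + 1)) _ _).symm.trans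
        ((C.pageMk_eq_zero 1 (p - k - 1) (k + 1) _).2 ?_))
      change C.d k (k + 1) (x.1 + C.d (k - 1) k b + c) - C.d k (k + 1) x.1 ∈ _
      rw [hd, add_sub_cancel_left]
      exact C.d_mem_B_of_mem_Z 0 (p - k - 1) k _ _ (by simp) rfl _ (C.F_le_Z_zero _ _ hc)

/-- Injectivity uses only the two entries of index 0: they give x ∈ F_{p-k-1} and dx ∈ F_{p-k-2},
which is membership in (Dec F)_{p-1}. -/
theorem decPageHom_zero_bijective (C : FilteredComplex.{u, v} R) (p k : ℤ) :
    Function.Bijective (C.decPageHom 0 p k) := by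
  constructor
  · refine (injective_iff_map_eq_zero _).2 fun x hx => ?_
    obtain ⟨x, rfl⟩ := C.decObj.pageMk_surjective 0 p k x
    rw [decPageHom_mk, LinearWitnessBook.quotMk_eq_zero] at hx
    replace hx : C.decNerve 0 p k x = 0 := hx
    have h₁ : C.pageMk 0 (p - k) k ⟨x.1, C.Z_dec_le 0 p k 0 (by omega) x.2⟩ = 0 :=
      congrFun (congrArg (fun t => t.1.1) hx) 0
    let q : ExtSpectralSequence.Target 1 (p - k) k :=
      ⟨(p - k - 1, k + 1), by dsimp only; push_cast; omega, rfl⟩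
    have h₂ : C.pageMk 0 (p - k - 1) (k + 1)
        ⟨C.d k (k + 1) x.1, C.d_mem_Z_of_mem_Z_dec 0 p k 0 q x.1 x.2⟩ = 0 :=
      congrFun (congrFun (congrArg (fun t => t.1.2) hx) 0) q
    rw [pageMk_eq_zero] at h₁ h₂
    refine (C.decObj.pageMk_eq_zero 0 p k x).2 ?_
    exact (C.mem_Z 1 (p - 1 - k) k (p - k - 1 - 1) (k + 1) (by push_cast; omega) rfl _).2
      ⟨C.mono _ _ _ (by omega) h₁, h₂⟩
  · exact Function.Surjective.of_comp (g := C.decObj.pageMk 0 p k)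
      ((C.extSpectralSequence.nerveObj.turnObj.quotMk_surjective 0 p k).comp
        (C.decNerveHom_zero_surjective p k))

/-! ### The natural isomorphism -/

theorem isIso_decComparison (C : FilteredComplex.{u, v} R) : IsIso C.decComparison :=
  ExtSpectralSequence.isIso_of_bijective _
    (ExtSpectralSequence.bijective_of_page_zero C.decObj.isSpectralSequence
      -- The target is a spectral sequence because the nerve of E(C) satisfies Im w = Ker d = Ker s
      -- and Ker w = Im s, and these conditions survive the page turn.
      (ExtSpectralSequence.IsSpectralSequence.nerve C.isSpectralSequence).turn.quot _
      C.decPageHom_zero_bijective)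

/-- The comparison `E(Dec C) ⟶ Dec (E(C))` as a natural transformation. -/
def decComparisonNatTrans (R : Type u) [CommRing R] :
    dec.{u, v} R ⋙ E R ⟶ E R ⋙ SpecSeq.dec R where
  app C := ⟨C.decComparison⟩
  naturality C D f := by
    refine ObjectProperty.hom_ext _ (ExtSpectralSequence.Hom.ext (funext fun r =>
      BigradedComplex.Hom.ext (funext fun p => funext fun k => LinearMap.ext fun x => ?_)))
    obtain ⟨x, rfl⟩ := C.decObj.pageMk_surjective r p k x
    refine congrArg (D.extSpectralSequence.nerveObj.turnObj.quotMk r p k) ?_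
    -- Naturality already holds for the representatives in the nerve: on the second row it is the
    -- fact that `f` commutes with the differentials.
    exact ExtSpectralSequence.nerve_ext (X := D.extSpectralSequence) (fun i => rfl) fun i q =>
      congrArg (D.pageMk i q.1.1 q.1.2) (Subtype.ext (homAt_d f k q.1.2 x.1).symm)

/-- The inclusion of spectral sequences into extended ones is fully faithful, so it reflects
isomorphisms. -/
instance (C : FilteredComplex.{u, v} R) : IsIso ((decComparisonNatTrans R).app C) :=
  haveI : IsIso ((ObjectProperty.ι ExtSpectralSequence.IsSpectralSequence).map
    ((decComparisonNatTrans R).app C)) := C.isIso_decComparison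
  isIso_of_fully_faithful (ObjectProperty.ι ExtSpectralSequence.IsSpectralSequence) _

end FilteredComplex

theorem mainTheorem11 (R : Type u) [CommRing R] :
    ∃ Φ : FilteredComplex.dec.{u, v} R ⋙ FilteredComplex.E R ≅
        FilteredComplex.E R ⋙ SpecSeq.dec R,
      ∀ (C : FilteredComplex.{u, v} R) (r : ℕ) (p k : ℤ) (x : C.decObj.Z r p k),
        ((Φ.hom.app C).hom.f r).f p k (C.decObj.pageMk r p k x) =
          C.extSpectralSequence.nerveObj.turnObj.quotMk r p k (C.decNerve r p k x) :=
  haveI := NatIso.isIso_of_isIso_app (FilteredComplex.decComparisonNatTrans.{u, v} R)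
  ⟨asIso (FilteredComplex.decComparisonNatTrans.{u, v} R), fun _ _ _ _ _ => rfl⟩
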